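/- Let $u,v$ be integers. The \emph{Lorenz-like template} $\mathscr{L}(u,v)\subset\mathbb{R}^3\subset\mathbb{S}^3$ is the branched surface obtained from the Lorenz template by cutting it along its branch line and gluing the left strip back with $u$ half twists and the right strip back with $v$ half twists (negative numbers meaning half twists of the opposite handedness; a positive half twist has the same handedness as the crossings of the left strip with the right strip). A \emph{$(u,v)$-Lorenz-like link} is a link $L$ embedded in $\mathscr{L}(u,v)$ each of whose components is a closed curve that runs through the strips in the direction of the semiflow, that is, a cyclic sequence of \emph{turns}, a turn being an arc that runs once through one strip from the branch line back to the branch line. Writing $x$ for a turn in the left strip and $y$ for a turn in the right strip gives a cyclic code word for each component. We assume that every component uses both strips; then $L$ has labelled code words $$w_a = x_{a,1}^{k_{a,1}}y_{a,1}^{l_{a,1}}\cdots x_{a,n_a}^{k_{a,n_a}}y_{a,n_a}^{l_{a,n_a}}\qquad(a=1,\dots,c),\qquad n_a\ge 1,\ k_{a,j},l_{a,j}\ge 1,$$ the second index being read modulo $n_a$. Let $\overline n=n_1+\dots+n_c$ be the trip number. Parallel components, i.e. several components with the same cyclic word, are allowed. The \emph{split template}: mark the branch line with integers from left to right, $0$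 being the point at which the two strips separate, so that the semiflow carries the mark $-k$ to the mark $-k+1$ and the mark $l$ to the mark $l-1$ for $k,l\ge1$; cut the template open along the flow lines that start at the marks. The $-k$-th interval is the part of the branch line between $-k$ and $-k+1$, the $+l$-th interval the part between $l-1$ and $l$. A turn in the left strip belongs to the $k$-th $x$-bunch if it starts in the $-k$-th interval and stays in the band of the split template that begins there; likewise the $l$-th $y$-bunch in the right strip is defined with the $+l$-th interval. A link with the above code words is a \emph{union of bunches of turns}, ordered from left to right by a given list of all base labels $x_{a,j}$ (the full $x$-bunch) and a given list of all base labels $y_{a,j}$ (the full $y$-bunch), if the turn of the $x_{a,j}^{k_{a,j}}$-arc that has $k$ turns of that arc to go (itself included) lies in the $k$-th $x$-bunch for $1\le k\le k_{a,j}$, the turn of the $y_{a,j}^{l_{a,j}}$-arc that has $l$ turns to go lies in the $l$-th $y$-bunch for $1\le l\le l_{a,j}$, and inside each bunch the turns are, at every time, ordered from left to right according to the list. In particular: (i) each $x_{a,j}^{k_{a,j}}$-arc starts from a point in the $-k_{a,j}$-th interval; (ii) each $y_{a,j}^{l_{a,j}}$-arc starts from a point in the $+l_{a,j}$-th interval.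 The \emph{generalised bunch algorithm}: order the base labels of the full $x$-bunch by lexicographic comparison of the exponents that follow, namely of the sequences $(l_{a,j},-k_{a,j+1},l_{a,j+1},-k_{a,j+2},\dots)$, and the base labels of the full $y$-bunch by lexicographic comparison of the sequences $(-k_{a,j+1},l_{a,j+1},-k_{a,j+2},l_{a,j+2},\dots)$; ties, which occur only between parallel components, are broken by the number $a$ of the component. In each negative (positive) interval draw $\overline n$ equally spaced points labelled by the $x$-base ($y$-base) labels, from left to right in the order of the full $x$-bunch ($y$-bunch). Draw the $x_{a,j}^{k_{a,j}}$-arc from the $x_{a,j}$-point of the $-k_{a,j}$-th interval through the $x_{a,j}$-points of the intervals $-k_{a,j}+1,\dots,-1$ to the $y_{a,j}$-point of the $+l_{a,j}$-th interval, and the $y_{a,j}^{l_{a,j}}$-arc from there through the $y_{a,j}$-points of the intervals $l_{a,j}-1,\dots,1$ to the $x_{a,j+1}$-point of the $-k_{a,j+1}$-th interval, each turn being straight in the coordinates of its strip; the strips carry their $u$ and $v$ half twists. \textbf{Theorem.} Let $u$ and $v$ be even and let $L$ be a $(u,v)$-Lorenz-like link with labelled code words $w_1,\dots,w_c$ as above.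 (1) $L$ is ambient isotopic, component by component and with orientations, to a link in $\mathscr{L}(u,v)$ with the same labelled code words that is a union of bunches of turns in the split template, ordered from left to right according to suitable lists of the base labels; in particular (i) and (ii) hold for it. (2) The generalised bunch algorithm constructs $L$ from its code words: the orders within the full bunches are well defined linear orders, the algorithm draws exactly one link $M$, the link $M$ is embedded in $\mathscr{L}(u,v)$, has the labelled code words $w_1,\dots,w_c$, and is a union of bunches of turns ordered by the computed orders; and $L$ is ambient isotopic to $M$ with orientations, each component of $L$ being carried to a component of $M$ with the same cyclic code word (hence to the component with the same number, if no two components of $L$ are parallel). -/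

import Mathlib

open Set

namespace LorenzLike

noncomputable section

/-- Euclidean three-space. -/
abbrev E3 : Type := EuclideanSpace ℝ (Fin 3)

/-! ### The Lorenz-like template

The template is written as a braided branched surface around the vertical axis. The half-plane at
angle `2 * π * t` is identified with a complex plane (real part: distance from the axis minus one;
imaginary part: height). The branch line is the segment `[0, 1]` of the half-plane `t = 0`, its
midpoint is the splitting point. The left strip leaves the left half of the branch line, the right
strip leaves the right half; each strip first narrows, then makes its half twists, and is then
stretched over the entire branch line, the left strip passing on one side of the right strip. A
positive half twist turns in the same sense as the crossings of the left strip with the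
right strip. -/

/-- The point of the half-plane at angle `2 * π * t` with complex coordinate `z`. -/
def page (t : ℝ) (z : ℂ) : E3 :=
  !₂[(1 + z.re) * Real.cos (2 * Real.pi * t), (1 + z.re) * Real.sin (2 * Real.pi * t), z.im]

/-- Progress of the narrowing phase, `0 ≤ t ≤ 1/3`. -/
def narrowing (t : ℝ) : ℝ := min 1 (3 * t)

/-- Progress of the twisting phase, `1/3 ≤ t ≤ 2/3`. -/
def twisting (t : ℝ) : ℝ := max 0 (min 1 (3 * t - 1))

/-- Progress of the merging phase, `2/3 ≤ t ≤ 1`. -/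
def merging (t : ℝ) : ℝ := max 0 (3 * t - 2)

/-- The width of either strip at time `t`: `1/2` at the start, `1/4` while twisting, `1` at the
end. -/
def width (t : ℝ) : ℝ := 1 / 2 - narrowing t / 4 + 3 / 4 * merging t

/-- The left strip with `u` half twists; `s ∈ [0, 1]` is the coordinate across the strip and
`t ∈ [0, 1]` is the time. It starts (`t = 0`) at the point `s / 2` of the branch line and
ends (`t = 1`) at the point `s` of the branch line if `u` is even, `1 - s` if `u` is odd. -/
def leftStrip (u : ℤ) (s t : ℝ) : E3 :=
  page t ((1 / 4 + merging t / 4 : ℝ) - (merging t * (1 - merging t) : ℝ) * Complex.I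
    + (width t * (s - 1 / 2) : ℝ) * Complex.exp ((Real.pi * u * twisting t : ℝ) * Complex.I))

/-- The right strip with `v` half twists; it starts at the point `(1 + s) / 2` of the branch line
and ends at the point `s` if `v` is even, `1 - s` if `v` is odd. -/
def rightStrip (v : ℤ) (s t : ℝ) : E3 :=
  page t ((3 / 4 - merging t / 4 : ℝ) + (merging t * (1 - merging t) : ℝ) * Complex.I
    + (width t * (s - 1 / 2) : ℝ) * Complex.exp ((Real.pi * v * twisting t : ℝ) * Complex.I))

/-- The leaf of the left strip at time `t`. -/
def leftLeaf (u : ℤ) (t : ℝ) : Set E3 := (fun s => leftStrip u s t) '' Icc 0 1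

/-- The leaf of the right strip at time `t`. -/
def rightLeaf (v : ℤ) (t : ℝ) : Set E3 := (fun s => rightStrip v s t) '' Icc 0 1

/-- The Lorenz-like template `𝓛(u, v)`. -/
def template (u v : ℤ) : Set E3 := ⋃ t ∈ Icc (0 : ℝ) 1, leftLeaf u t ∪ rightLeaf v t

/-! ### Links in the template -/

/-- `L` is a link with `c` components embedded in the template `𝓛(u, v)`. The component `a` is the
closed curve `L a`, of period `m a`; between two consecutive integer times it makes one turn, that
is, it runs once, in the direction of the semiflow, through one of the strips, from the branch line
back to the branch line, meeting each leaf of that strip once. The curves are simple and pairwise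
disjoint. -/
structure IsLorenzLikeLink (u v : ℤ) {c : ℕ} (m : Fin c → ℕ) (L : Fin c → ℝ → E3) : Prop where
  period_pos : ∀ a, 0 < m a
  continuous : ∀ a, Continuous (L a)
  periodic : ∀ a, Function.Periodic (L a) (m a)
  mem_template : ∀ a τ, L a τ ∈ template u v
  turn : ∀ a (j : ℕ), (∀ t ∈ Icc (0 : ℝ) 1, L a (j + t) ∈ leftLeaf u t) ∨
    (∀ t ∈ Icc (0 : ℝ) 1, L a (j + t) ∈ rightLeaf v t)
  embedded : ∀ a b τ τ', L a τ = L b τ' → a = b ∧ ∃ q : ℤ, τ' = τ + q * m a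

/-- Ambient isotopy of parametrised links. The isotopy is constant outside a ball, so it extends to
the three-sphere. -/
def AmbientIsotopic {c : ℕ} (L L' : Fin c → ℝ → E3) : Prop :=
  ∃ H : unitInterval → (E3 ≃ₜ E3),
    Continuous (fun p : unitInterval × E3 => H p.1 p.2) ∧
    (∀ x, H 0 x = x) ∧
    (∃ R : ℝ, ∀ s x, R ≤ ‖x‖ → H s x = x) ∧
    ∀ a τ, H 1 (L a τ) = L' a τ

/-! ### Labelled code words -/

/-- Code words of `c` components: the word of the component `a` is
`x ^ k a 0 * y ^ l a 0 * x ^ k a 1 * y ^ l a 1 * ⋯ * x ^ k a (n a - 1) * y ^ l a (n a - 1)`, with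
word period `n a ≥ 1` and exponents at least one. The exponents are indexed cyclically, that is,
periodically by all natural numbers. The base labels are the pairs of a component `a` and an index
below `n a`. -/
structure CodeWords (c : ℕ) where
  n : Fin c → ℕ
  k : Fin c → ℕ → ℕ
  l : Fin c → ℕ → ℕ
  n_pos : ∀ a, 0 < n a
  k_pos : ∀ a j, 0 < k a j
  l_pos : ∀ a j, 0 < l a j
  k_periodic : ∀ a j, k a (j + n a) = k a j
  l_periodic : ∀ a j, l a (j + n a) = l a j

namespace CodeWords

variable {c : ℕ} (W : CodeWords c)

/-- The base labels: `⟨a, j⟩` labels the subword `x ^ k a j * y ^ l a j`. -/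
abbrev Base : Type := (a : Fin c) × Fin (W.n a)

/-- The sum of the word periods (the trip number). -/
def trip : ℕ := ∑ a, W.n a

/-- The number of letters before the subword `x ^ k a j`, which is the time at which the
corresponding arc starts. -/
def xStart (a : Fin c) (j : ℕ) : ℕ := ∑ i ∈ Finset.range j, (W.k a i + W.l a i)

/-- The number of letters before the subword `y ^ l a j`. -/
def yStart (a : Fin c) (j : ℕ) : ℕ := W.xStart a j + W.k a j

/-- The length of the word of the component `a`. -/
def length (a : Fin c) : ℕ := W.xStart a (W.n a)

/-- `W` is the family of code words of the link `L`: for each subword `x ^ k a j * y ^ l a j` the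
curve `L a` makes `k a j` turns in the left strip, and then `l a j` turns in the right strip. -/
def IsCodeOf (u v : ℤ) (L : Fin c → ℝ → E3) : Prop :=
  ∀ a j, (∀ r < W.k a j, ∀ t ∈ Icc (0 : ℝ) 1, L a ((W.xStart a j + r : ℕ) + t) ∈ leftLeaf u t) ∧
    (∀ r < W.l a j, ∀ t ∈ Icc (0 : ℝ) 1, L a ((W.yStart a j + r : ℕ) + t) ∈ rightLeaf v t)

/-! ### Orders within the full bunches -/

/-- The exponents after the subword `x ^ k a j`, those of `x` with a minus sign:
`l_j, -k_{j+1}, l_{j+1}, -k_{j+2}, …`. -/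
def xTail (a : Fin c) (j : ℕ) (m : ℕ) : ℤ :=
  if Even m then (W.l a (j + m / 2) : ℤ) else -(W.k a (j + m / 2 + 1) : ℤ)

/-- The exponents after the subword `y ^ l a j`, those of `x` with a minus sign:
`-k_{j+1}, l_{j+1}, -k_{j+2}, l_{j+2}, …`. -/
def yTail (a : Fin c) (j : ℕ) (m : ℕ) : ℤ :=
  if Even m then -(W.k a (j + m / 2 + 1) : ℤ) else (W.l a (j + m / 2 + 1) : ℤ)

/-- The lexicographic order of sequences. -/
def LexLT (e f : ℕ → ℤ) : Prop := ∃ m, (∀ q < m, e q = f q) ∧ e m < f m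

/-- The label `(a, j)` comes before `(b, i)` in the full `x`-bunch: the exponents that follow are
compared lexicographically (smaller `y`-exponents and larger `x`-exponents first). Parallel
components are ordered by their number. -/
def XBefore (a : Fin c) (j : ℕ) (b : Fin c) (i : ℕ) : Prop :=
  LexLT (W.xTail a j) (W.xTail b i) ∨ (W.xTail a j = W.xTail b i ∧ a < b)

/-- The label `(a, j)` comes before `(b, i)` in the full `y`-bunch. -/
def YBefore (a : Fin c) (j : ℕ) (b : Fin c) (i : ℕ) : Prop :=
  LexLT (W.yTail a j) (W.yTail b i) ∨ (W.yTail a j = W.yTail b i ∧ a < b)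

/-- The number of labels before `(a, j)` in the full `x`-bunch. -/
def xRank (a : Fin c) (j : ℕ) : ℕ := {i : W.Base | W.XBefore i.1 i.2 a j}.ncard

/-- The number of labels before `(a, j)` in the full `y`-bunch. -/
def yRank (a : Fin c) (j : ℕ) : ℕ := {i : W.Base | W.YBefore i.1 i.2 a j}.ncard

end CodeWords

/-! ### The split template

The branch line is marked with integers: `0` is the splitting point, and the semiflow carries the
mark `-k` to the mark `-k + 1` and the mark `l` to the mark `l - 1` for `k, l ≥ 1`. The template is
cut open along the flow lines that start at the marks. -/

/-- The position of the mark `z` on the branch line `[0, 1]`. -/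
def mark (z : ℤ) : ℝ :=
  if z ≤ 0 then (1 / 2) ^ (z.natAbs + 1) else 1 - (1 / 2) ^ (z.natAbs + 1)

/-- The `-k`-th interval of the branch line, `k ≥ 1`. -/
def negInterval (k : ℕ) : Set ℝ := Ioo (mark (-k)) (mark (-k + 1))

/-- The `+l`-th interval of the branch line, `l ≥ 1`. -/
def posInterval (l : ℕ) : Set ℝ := Ioo (mark (l - 1)) (mark l)

/-- The band of the split left strip that starts at the `-k`-th interval, in the coordinate across
the strip; it ends at the `-(k-1)`-th interval if `k ≥ 2`, and at the positive half of the branch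
line if `k = 1`. -/
def xBand (k : ℕ) : Set ℝ := Icc (2 * mark (-k)) (2 * mark (-k + 1))

/-- The band of the split right strip that starts at the `+l`-th interval. -/
def yBand (l : ℕ) : Set ℝ := Icc (2 * mark (l - 1) - 1) (2 * mark l - 1)

/-- The link `L` with code words `W` is a union of bunches of turns in the split template, each
bunch ordered from left to right according to the lists `ρx` and `ρy` of the base labels in the full
`x`-bunch and in the full `y`-bunch. The turn with label `i` in the `k`-th `x`-bunch, `1 ≤ k ≤ k_i`,
is the turn of the `x_i ^ k_i`-arc that has `k` turns of the arc to go, itself included; its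
coordinate across the left strip at time `t` is `X i k t`. It starts in the `-k`-th interval
(in particular the arc, whose first turn is in the `k_i`-th bunch, starts in the `-k_i`-th
interval), and it stays in the band that starts there. Likewise for `Y`, the right strip and the
positive intervals. -/
def IsUnionOfBunches (u v : ℤ) {c : ℕ} (W : CodeWords c) (ρx ρy : W.Base ≃ Fin W.trip)
    (L : Fin c → ℝ → E3) : Prop :=
  ∃ X Y : W.Base → ℕ → ℝ → ℝ,
    (∀ i : W.Base, ∀ k, 1 ≤ k → k ≤ W.k i.1 i.2 →
      X i k 0 / 2 ∈ negInterval k ∧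
      ∀ t ∈ Icc (0 : ℝ) 1, X i k t ∈ xBand k ∧
        L i.1 ((W.xStart i.1 i.2 + (W.k i.1 i.2 - k) : ℕ) + t) = leftStrip u (X i k t) t) ∧
    (∀ i : W.Base, ∀ l, 1 ≤ l → l ≤ W.l i.1 i.2 →
      (1 + Y i l 0) / 2 ∈ posInterval l ∧
      ∀ t ∈ Icc (0 : ℝ) 1, Y i l t ∈ yBand l ∧
        L i.1 ((W.yStart i.1 i.2 + (W.l i.1 i.2 - l) : ℕ) + t) = rightStrip v (Y i l t) t) ∧
    (∀ i i' : W.Base, ρx i < ρx i' → ∀ k, 1 ≤ k → k ≤ W.k i.1 i.2 → k ≤ W.k i'.1 i'.2 →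
      ∀ t ∈ Icc (0 : ℝ) 1, X i k t < X i' k t) ∧
    (∀ i i' : W.Base, ρy i < ρy i' → ∀ l, 1 ≤ l → l ≤ W.l i.1 i.2 → l ≤ W.l i'.1 i'.2 →
      ∀ t ∈ Icc (0 : ℝ) 1, Y i l t < Y i' l t)

/-! ### The bunch algorithm -/

namespace CodeWords

variable {c : ℕ} (W : CodeWords c)

/-- The point with `x`-base label `(a, j)` among the points drawn in the `-k`-th interval: one point
for each label, equally spaced, in the order of the full `x`-bunch. -/
def xPoint (k : ℕ) (a : Fin c) (j : ℕ) : ℝ :=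
  mark (-k) + (W.xRank a j + 1) / (W.trip + 1) * (mark (-k + 1) - mark (-k))

/-- The point with `y`-base label `(a, j)` among the points drawn in the `+l`-th interval. -/
def yPoint (l : ℕ) (a : Fin c) (j : ℕ) : ℝ :=
  mark (l - 1) + (W.yRank a j + 1) / (W.trip + 1) * (mark l - mark (l - 1))

end CodeWords

/-- The turn in the left strip from the point `p` to the point `q` of the branch line that is
straight in the strip coordinates. -/
def leftTurn (u : ℤ) (p q t : ℝ) : E3 := leftStrip u ((1 - t) * (2 * p) + t * q) t

/-- The turn in the right strip from the point `p` to the point `q` of the branch line that is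
straight in the strip coordinates. -/
def rightTurn (v : ℤ) (p q t : ℝ) : E3 := rightStrip v ((1 - t) * (2 * p - 1) + t * q) t

/-- `M` is the link drawn by the generalised bunch algorithm from the code words `W`, with `u` and
`v` half twists on the two strips. The `x_j ^ k_j`-arc starts at the `x_j`-point of the `-k_j`-th
interval, passes through the `x_j`-points of the intervals `-k_j + 1, …, -1`, and ends at the
`y_j`-point of the `+l_j`-th interval; the `y_j ^ l_j`-arc starts there, passes through the
`y_j`-points of the intervals `l_j - 1, …, 1`, and ends at the `x_{j+1}`-point of the
`-k_{j+1}`-th interval. -/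
structure IsBunchDrawing (u v : ℤ) {c : ℕ} (W : CodeWords c) (M : Fin c → ℝ → E3) : Prop where
  periodic : ∀ a, Function.Periodic (M a) (W.length a)
  x_turn : ∀ a j k, 2 ≤ k → k ≤ W.k a j → ∀ t ∈ Icc (0 : ℝ) 1,
    M a ((W.xStart a j + (W.k a j - k) : ℕ) + t) =
      leftTurn u (W.xPoint k a j) (W.xPoint (k - 1) a j) t
  x_last : ∀ a j, ∀ t ∈ Icc (0 : ℝ) 1,
    M a ((W.xStart a j + (W.k a j - 1) : ℕ) + t) =
      leftTurn u (W.xPoint 1 a j) (W.yPoint (W.l a j) a j) t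
  y_turn : ∀ a j l, 2 ≤ l → l ≤ W.l a j → ∀ t ∈ Icc (0 : ℝ) 1,
    M a ((W.yStart a j + (W.l a j - l) : ℕ) + t) =
      rightTurn v (W.yPoint l a j) (W.yPoint (l - 1) a j) t
  y_last : ∀ a j, ∀ t ∈ Icc (0 : ℝ) 1,
    M a ((W.yStart a j + (W.l a j - 1) : ℕ) + t) =
      rightTurn v (W.yPoint 1 a j) (W.xPoint (W.k a (j + 1)) a (j + 1)) t

end

end LorenzLike

open LorenzLike

/-!
The pages are the half-planes bounded by the vertical axis, and a link in the template is a closed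
braid: it meets each page in finitely many points, which move continuously with the angle. An
isotopy of closed braids can be built page by page. If a vector field on each page is Lipschitz with
constant `1/2`, depends continuously and periodically on the angle, and has bounded support away
from the axis, then adding it to the identity is a homeomorphism of space isotopic to the identity
(`IsPageField.ambientIsotopic`). Such fields, made of bumps around the strands, push a closed braid
to any nearby one; with compactness, two closed braids are isotopic as soon as their strands stay
disjoint under linear interpolation in the pages (`ambientIsotopic_of_interpolation`).

For two links in the template with the same words, this holds if their points on the branch line are
in the same order: strands in the same strip keep their order, and strands in different strips are
disjoint (`IsCodedLink.ambientIsotopic_of_pos`). As the numbers of half twists are even, both strips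
carry the order at their start to the order at their end. Therefore points with different
itineraries are ordered by the first letter where they differ, and the words determine their order.
Points with the same itinerary lie on parallel components: a strand that precedes a shift of itself
would precede itself after finitely many shifts, so the words of an embedded link are primitive
(`IsCodedLink.eq_of_itinerary`, `IsCodedLink.primitive`). In a class of parallel components the
order of the strands is an order of the components (`IsCodedLink.pos_lt_iff_of_itinerary`).

The points of the bunch algorithm are ordered first by their intervals and then by their ranks in
the full bunches. Since the order in a full bunch is lexicographic, deleting an equal first exponent
passes from the order in the one full bunch to that in the other, so the turns drawn preserve the
order of the points (`CodeWords.point_succ_lt`) and do not cross. Primitivity of the words makes the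
points drawn distinct (`CodeWords.Primitive.eq_of_point_eq`). Hence the drawing is an embedded link
with the given words, in which parallel components are ordered by their numbers. Permuting the
parallel components so that their order is that in the given link gives the isotopy
(`IsCodedLink.exists_ambientIsotopic`), and the permuted drawing is also the union of bunches that
keeps the labels of the components.
-/

namespace LorenzLike

/-! ### Ambient isotopies that preserve the pages -/

theorem AmbientIsotopic.refl {c : ℕ} (L : Fin c → ℝ → E3) : AmbientIsotopic L L :=
  ⟨fun _ => Homeomorph.refl _, by simpa using continuous_snd, fun _ => rfl,
    ⟨0, fun _ _ _ => rfl⟩, fun _ _ => rfl⟩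

theorem AmbientIsotopic.trans {c : ℕ} {L₁ L₂ L₃ : Fin c → ℝ → E3}
    (h₁ : AmbientIsotopic L₁ L₂) (h₂ : AmbientIsotopic L₂ L₃) : AmbientIsotopic L₁ L₃ := by
  obtain ⟨H, hc, h0, ⟨R, hR⟩, h1⟩ := h₁
  obtain ⟨H', hc', h0', ⟨R', hR'⟩, h1'⟩ := h₂
  refine ⟨fun s => (H s).trans (H' s), ?_, fun x => by simp [h0, h0'],
    ⟨max R R', fun s x hx => ?_⟩, fun a τ => by simp [h1, h1']⟩
  · exact hc'.comp (continuous_fst.prodMk hc)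
  · simp [hR s x (le_trans (le_max_left _ _) hx), hR' s x (le_trans (le_max_right _ _) hx)]

/-- The linear part of `page t`. -/
noncomputable def pageVec (t : ℝ) (z : ℂ) : E3 :=
  !₂[z.re * Real.cos (2 * Real.pi * t), z.re * Real.sin (2 * Real.pi * t), z.im]

theorem page_add (t : ℝ) (z w : ℂ) : page t (z + w) = page t z + pageVec t w := by
  ext i
  fin_cases i <;> simp [page, pageVec] <;> ring

theorem pageVec_smul (t s : ℝ) (z : ℂ) : pageVec t (s • z) = s • pageVec t z := by
  ext i
  fin_cases i <;> simp [pageVec] <;> ring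

theorem pageVec_zero (t : ℝ) : pageVec t 0 = 0 := by
  ext i
  fin_cases i <;> simp [pageVec]

theorem continuous_pageVec : Continuous (fun p : ℝ × ℂ => pageVec p.1 p.2) := by
  unfold pageVec
  refine (PiLp.continuous_toLp 2 _).comp (continuous_pi fun i => ?_)
  fin_cases i <;> simp <;> fun_prop

theorem continuous_page : Continuous (fun p : ℝ × ℂ => page p.1 p.2) := by
  unfold page
  refine (PiLp.continuous_toLp 2 _).comp (continuous_pi fun i => ?_)
  fin_cases i <;> simp <;> fun_prop

theorem page_add_int (t : ℝ) (k : ℤ) (z : ℂ) : page (t + k) z = page t z := by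
  have h : 2 * Real.pi * (t + k) = 2 * Real.pi * t + k * (2 * Real.pi) := by ring
  simp only [page, h, Real.cos_add_int_mul_two_pi, Real.sin_add_int_mul_two_pi]

theorem page_add_nat (t : ℝ) (k : ℕ) (z : ℂ) : page (t + k) z = page t z :=
  mod_cast page_add_int t k z

theorem pageVec_add_int (t : ℝ) (k : ℤ) (z : ℂ) : pageVec (t + k) z = pageVec t z := by
  have h : 2 * Real.pi * (t + k) = 2 * Real.pi * t + k * (2 * Real.pi) := by ring
  simp only [pageVec, h, Real.cos_add_int_mul_two_pi, Real.sin_add_int_mul_two_pi]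

/-- The projection of a point to the horizontal plane, as a complex number. -/
noncomputable def horiz (x : E3) : ℂ := ⟨x 0, x 1⟩

/-- The angle of the page through `x`, measured so that a full turn is `1`. -/
noncomputable def angle (x : E3) : ℝ := Complex.arg (horiz x) / (2 * Real.pi)

/-- The complex coordinate of `x` in the page through `x`. -/
noncomputable def profile (x : E3) : ℂ := ⟨‖horiz x‖ - 1, x 2⟩

theorem continuous_horiz : Continuous horiz := by
  have : horiz = fun x : E3 => ((x 0 : ℝ) : ℂ) + (x 1 : ℝ) * Complex.I := by
    funext x
    apply Complex.ext <;> simp [horiz]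
  rw [this]
  fun_prop

theorem continuous_profile : Continuous profile := by
  have : profile = fun x : E3 => ((‖horiz x‖ - 1 : ℝ) : ℂ) + (x 2 : ℝ) * Complex.I := by
    funext x
    apply Complex.ext <;> simp [profile]
  rw [this]
  have := continuous_horiz
  fun_prop

theorem page_of_horiz {x : E3} {t : ℝ}
    (h : horiz x = ‖horiz x‖ * Complex.exp ((2 * Real.pi * t : ℝ) * Complex.I)) :
    page t (profile x) = x := by
  have hre := congrArg Complex.re h
  have him := congrArg Complex.im h
  rw [Complex.re_ofReal_mul, Complex.exp_ofReal_mul_I_re] at hre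
  rw [Complex.im_ofReal_mul, Complex.exp_ofReal_mul_I_im] at him
  ext i
  fin_cases i
  · simpa [page, profile] using hre.symm.trans (show (horiz x).re = x 0 from rfl)
  · simpa [page, profile] using him.symm.trans (show (horiz x).im = x 1 from rfl)
  · simp [page, profile]

theorem page_angle_profile (x : E3) : page (angle x) (profile x) = x := by
  apply page_of_horiz
  have h : 2 * Real.pi * angle x = Complex.arg (horiz x) := by
    unfold angle
    field_simp
  rw [h, Complex.norm_mul_exp_arg_mul_I]

theorem horiz_page (t : ℝ) (z : ℂ) :
    horiz (page t z) = (1 + z.re : ℝ) *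
      (Complex.cos (2 * Real.pi * t : ℝ) + Complex.sin (2 * Real.pi * t : ℝ) * Complex.I) := by
  rw [← Complex.ofReal_cos, ← Complex.ofReal_sin]
  apply Complex.ext
  · rw [Complex.re_ofReal_mul, Complex.add_re, Complex.ofReal_re, Complex.re_ofReal_mul]
    simp [horiz, page]
  · rw [Complex.im_ofReal_mul, Complex.add_im, Complex.ofReal_im, Complex.im_ofReal_mul]
    simp [horiz, page]

theorem profile_page (t : ℝ) {z : ℂ} (hz : -1 ≤ z.re) : profile (page t z) = z := by
  have h : ‖horiz (page t z)‖ = 1 + z.re := by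
    rw [horiz_page, norm_mul, Complex.cos_add_sin_I, Complex.norm_exp_ofReal_mul_I,
      Complex.norm_real, Real.norm_eq_abs, abs_of_nonneg (by linarith), mul_one]
  apply Complex.ext
  · simp [profile, h]
  · simp [profile, page]

theorem angle_page (t : ℝ) {z : ℂ} (hz : -1 < z.re) : ∃ k : ℤ, angle (page t z) = t + k := by
  have h := Complex.arg_mul_cos_add_sin_mul_I_coe_angle (r := 1 + z.re) (by linarith)
    ((2 * Real.pi * t : ℝ) : Real.Angle)
  have h' : (Complex.arg (horiz (page t z)) : Real.Angle) =
      ((2 * Real.pi * t : ℝ) : Real.Angle) := by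
    rw [← h, horiz_page]
    simp
  obtain ⟨k, hk⟩ := Real.Angle.angle_eq_iff_two_pi_dvd_sub.1 h'
  refine ⟨k, ?_⟩
  unfold angle
  field_simp
  linarith

/-- Away from the axis, equal points lie on the same page. -/
theorem page_inj {t t' : ℝ} {z z' : ℂ} (hz : -1 < z.re) (hz' : -1 ≤ z'.re)
    (h : page t z = page t' z') : z = z' ∧ ∃ k : ℤ, t' = t + k := by
  have h1 : z = z' := by
    rw [← profile_page t hz.le, h, profile_page t' hz']
  refine ⟨h1, ?_⟩
  obtain ⟨k, hk⟩ := angle_page t hz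
  obtain ⟨k', hk'⟩ := angle_page t' (h1 ▸ hz)
  rw [← h, hk] at hk'
  exact ⟨k - k', by push_cast; linarith⟩

/-- A family of vector fields on the pages, one for each angle `t`, which is `1`-periodic in `t`,
continuous, a contraction on each page, and vanishes near the axis and outside a ball. -/
structure IsPageField (V : ℝ → ℂ → ℂ) : Prop where
  continuous : Continuous (fun p : ℝ × ℂ => V p.1 p.2)
  periodic : ∀ z, Function.Periodic (fun t => V t z) 1
  contracting : ∀ t z z', ‖V t z - V t z'‖ ≤ 1 / 2 * ‖z - z'‖
  axis : ∀ t z, z.re ≤ -1 / 2 → V t z = 0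
  bounded : ∃ R : ℝ, ∀ t z, R ≤ ‖z‖ → V t z = 0

/-- The vector field on space made of the vector fields `V t` on the pages. -/
noncomputable def spaceField (V : ℝ → ℂ → ℂ) (x : E3) : E3 :=
  pageVec (angle x) (V (angle x) (profile x))

namespace IsPageField

variable {V : ℝ → ℂ → ℂ} (hV : IsPageField V)
include hV

theorem add_int (t : ℝ) (k : ℤ) (z : ℂ) : V (t + k) z = V t z := by
  simpa using (hV.periodic z).int_mul k t

theorem spaceField_page (t : ℝ) {z : ℂ} (hz : -1 < z.re) :
    spaceField V (page t z) = pageVec t (V t z) := by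
  obtain ⟨k, hk⟩ := angle_page t hz
  rw [spaceField, hk, profile_page t hz.le, hV.add_int, pageVec_add_int]

theorem continuous_spaceField : Continuous (spaceField V) := by
  have hΨ : Continuous (fun p : ℝ × ℂ => pageVec p.1 (V p.1 p.2)) :=
    continuous_pageVec.comp (continuous_fst.prodMk hV.continuous)
  rw [continuous_iff_continuousAt]
  intro x
  by_cases hx : (profile x).re < -1 / 2
  · have : ∀ᶠ y in nhds x, (profile y).re < -1 / 2 :=
      (Complex.continuous_re.comp continuous_profile).continuousAt.eventually_lt
        continuousAt_const hx
    refine (continuousAt_const (y := (0 : E3))).congr (this.mono fun y hy => ?_)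
    rw [spaceField, hV.axis _ _ hy.le, pageVec_zero]
  · have h0 : horiz x ≠ 0 := by
      intro h
      apply hx
      simp only [profile, h, norm_zero]
      norm_num
    -- two branches of the angle are needed, cut along opposite half-planes
    rcases Complex.mem_slitPlane_or_neg_mem_slitPlane h0 with h | h
    · have hang : ContinuousAt angle x :=
        ((Complex.continuousAt_arg h).comp continuous_horiz.continuousAt).div_const _
      exact ContinuousAt.comp (f := fun y => (angle y, profile y)) hΨ.continuousAt
        (hang.prodMk continuous_profile.continuousAt)
    · have hang : ContinuousAt
          (fun y => Complex.arg (-horiz y) / (2 * Real.pi) + 1 / 2) x :=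
        ((ContinuousAt.comp (f := fun y => -horiz y) (Complex.continuousAt_arg h)
          continuous_horiz.neg.continuousAt).div_const _).add_const _
      have hc := ContinuousAt.comp
        (f := fun y => (Complex.arg (-horiz y) / (2 * Real.pi) + 1 / 2, profile y))
        hΨ.continuousAt (hang.prodMk continuous_profile.continuousAt)
      have hev : ∀ᶠ y in nhds x, horiz y ≠ 0 := continuous_horiz.continuousAt.eventually_ne h0
      refine hc.congr (hev.mono fun y hy => ?_)
      have hp : page (Complex.arg (-horiz y) / (2 * Real.pi) + 1 / 2) (profile y) = y := by
        apply page_of_horiz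
        have h1 : 2 * Real.pi * (Complex.arg (-horiz y) / (2 * Real.pi) + 1 / 2)
            = Complex.arg (-horiz y) + Real.pi := by field_simp
        have h2 := Complex.norm_mul_exp_arg_mul_I (-horiz y)
        rw [h1, Complex.ofReal_add, add_mul, Complex.exp_add, Complex.exp_pi_mul_I]
        rw [norm_neg] at h2
        linear_combination h2
      have hr : -1 < (profile y).re := by
        simp only [profile]
        have := norm_pos_iff.2 hy
        linarith
      conv_rhs => rw [← hp]
      exact (hV.spaceField_page _ hr).symm

theorem norm_smul_le {s : ℝ} (hs : s ∈ Icc (0 : ℝ) 1) (t : ℝ) (z z' : ℂ) :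
    ‖s • V t z - s • V t z'‖ ≤ 1 / 2 * ‖z - z'‖ := by
  rw [← smul_sub, norm_smul, Real.norm_eq_abs, abs_of_nonneg hs.1]
  have := hV.contracting t z z'
  have h0 := norm_nonneg (V t z - V t z')
  nlinarith [hs.2, hs.1]

/-- The displaced points stay off the axis. -/
theorem lt_re {s : ℝ} (hs : s ∈ Icc (0 : ℝ) 1) (t : ℝ) {z : ℂ} (hz : -1 < z.re) :
    -1 < (z + s • V t z).re := by
  by_cases h : z.re ≤ -1 / 2
  · simpa [hV.axis t z h] using hz
  · push Not at h
    have h1 := hV.norm_smul_le hs t z ⟨-1 / 2, z.im⟩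
    rw [hV.axis t ⟨-1 / 2, z.im⟩ (le_of_eq rfl), smul_zero, sub_zero] at h1
    have h2 : z - ⟨-1 / 2, z.im⟩ = ((z.re + 1 / 2 : ℝ) : ℂ) := by
      apply Complex.ext <;> simp
      ring
    rw [h2, Complex.norm_real, Real.norm_eq_abs, abs_of_nonneg (by linarith)] at h1
    have h3 := (abs_le.1 (Complex.abs_re_le_norm (s • V t z))).1
    rw [Complex.add_re]
    linarith

theorem injective_page {s : ℝ} (hs : s ∈ Icc (0 : ℝ) 1) (t : ℝ) :
    Function.Injective (fun z => z + s • V t z) := by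
  intro z z' h
  have h1 := hV.norm_smul_le hs t z z'
  have h2 : s • V t z - s • V t z' = -(z - z') := by
    simp only at h
    linear_combination h
  rw [h2, norm_neg] at h1
  have h3 : ‖z - z'‖ = 0 := le_antisymm (by linarith) (norm_nonneg _)
  exact sub_eq_zero.1 (norm_eq_zero.1 h3)

theorem surjective_page {s : ℝ} (hs : s ∈ Icc (0 : ℝ) 1) (t : ℝ) :
    Function.Surjective (fun z => z + s • V t z) := by
  intro w
  have hc : ContractingWith (1 / 2) (fun z => w - s • V t z) := by
    refine ⟨by norm_num, LipschitzWith.of_dist_le_mul fun z z' => ?_⟩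
    rw [dist_eq_norm, dist_eq_norm, sub_sub_sub_cancel_left, norm_sub_rev]
    simpa using hV.norm_smul_le hs t z z'
  refine ⟨hc.fixedPoint, ?_⟩
  have : w - s • V t hc.fixedPoint = hc.fixedPoint := hc.fixedPoint_isFixedPt
  simp only
  linear_combination -this

theorem add_spaceField_page (s t : ℝ) {z : ℂ} (hz : -1 < z.re) :
    page t z + s • spaceField V (page t z) = page t (z + s • V t z) := by
  rw [hV.spaceField_page t hz, page_add, pageVec_smul]

theorem spaceField_axis {x : E3} (hx : (profile x).re ≤ -1 / 2) : spaceField V x = 0 := by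
  rw [spaceField, hV.axis _ _ hx, pageVec_zero]

theorem bijective {s : ℝ} (hs : s ∈ Icc (0 : ℝ) 1) :
    Function.Bijective (fun x => x + s • spaceField V x) := by
  have key : ∀ x : E3, -1 < (profile x).re → x + s • spaceField V x =
      page (angle x) (profile x + s • V (angle x) (profile x)) := fun x hx => by
    conv_lhs => rw [← page_angle_profile x]
    exact hV.add_spaceField_page s _ hx
  have ax : ∀ x : E3, ¬ -1 < (profile x).re → x + s • spaceField V x = x := fun x hx => by
    rw [hV.spaceField_axis (by linarith), smul_zero, add_zero]
  constructor
  · intro x y h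
    simp only at h
    by_cases hx : -1 < (profile x).re <;> by_cases hy : -1 < (profile y).re
    · rw [key x hx, key y hy] at h
      obtain ⟨h1, k, hk⟩ := page_inj (hV.lt_re hs _ hx) (hV.lt_re hs _ hy).le h
      rw [hk, hV.add_int] at h1
      rw [← page_angle_profile x, ← page_angle_profile y, hk, page_add_int,
        hV.injective_page hs _ h1]
    · rw [key x hx, ax y hy] at h
      rw [← h, profile_page _ (hV.lt_re hs _ hx).le] at hy
      exact absurd (hV.lt_re hs _ hx) hy
    · rw [ax x hx, key y hy] at h
      rw [h, profile_page _ (hV.lt_re hs _ hy).le] at hx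
      exact absurd (hV.lt_re hs _ hy) hx
    · rwa [ax x hx, ax y hy] at h
  · intro y
    by_cases hy : -1 < (profile y).re
    · obtain ⟨z, hz⟩ := hV.surjective_page hs (angle y) (profile y)
      simp only at hz
      have hr : -1 < z.re := by
        by_cases h : z.re ≤ -1 / 2
        · rw [hV.axis _ _ h, smul_zero, add_zero] at hz
          rwa [hz]
        · linarith
      exact ⟨page (angle y) z, by
        simp only [hV.add_spaceField_page s _ hr, hz, page_angle_profile]⟩
    · exact ⟨y, ax y hy⟩

theorem exists_spaceField_eq_zero : ∃ R : ℝ, ∀ x, R ≤ ‖x‖ → spaceField V x = 0 := by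
  obtain ⟨R, hR⟩ := hV.bounded
  have hK : IsCompact ((fun p : ℝ × ℂ => page p.1 p.2) '' (Icc (-1) 1 ×ˢ Metric.closedBall 0 R)) :=
    (isCompact_Icc.prod (isCompact_closedBall (0 : ℂ) R)).image continuous_page
  obtain ⟨R', hR'⟩ := hK.isBounded.exists_norm_le
  refine ⟨R' + 1, fun x hx => ?_⟩
  rw [spaceField, hR, pageVec_zero]
  by_contra! h
  have := hR' x ⟨(angle x, profile x), ⟨?_, by simpa using h.le⟩, page_angle_profile x⟩
  · linarith
  · have h1 := Complex.neg_pi_lt_arg (horiz x)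
    have h2 := Complex.arg_le_pi (horiz x)
    have := Real.pi_pos
    constructor <;> simp only [angle]
    · rw [le_div_iff₀ (by positivity)]; linarith
    · rw [div_le_iff₀ (by positivity)]; linarith

/-- Displacing all points along the field of a page field is a homeomorphism: it is the identity
outside a compact set, hence proper. -/
noncomputable def displacement {s : ℝ} (hs : s ∈ Icc (0 : ℝ) 1) : E3 ≃ₜ E3 :=
  (Equiv.ofBijective _ (hV.bijective hs)).toHomeomorphOfContinuousClosed
    (continuous_id.add (hV.continuous_spaceField.const_smul s))
    (by
      refine IsProperMap.isClosedMap (isProperMap_iff_tendsto_cocompact.2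
        ⟨continuous_id.add (hV.continuous_spaceField.const_smul s), ?_⟩)
      obtain ⟨R, hR⟩ := hV.exists_spaceField_eq_zero
      refine Filter.Tendsto.congr' ?_ Filter.tendsto_id
      have := tendsto_norm_cocompact_atTop (E := E3)
      filter_upwards [this.eventually_ge_atTop R] with x hx
      simp [hR x hx])

theorem displacement_apply {s : ℝ} (hs : s ∈ Icc (0 : ℝ) 1) (x : E3) :
    hV.displacement hs x = x + s • spaceField V x := rfl

/-- Scaling a page field from `0` to `1` moves every point `ζ a τ` in its page along a segment to
`ζ' a τ`, if the field has the value `ζ' a τ - ζ a τ` there. -/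
theorem ambientIsotopic {c : ℕ} (ζ ζ' : Fin c → ℝ → ℂ) (hre : ∀ a τ, -1 < (ζ a τ).re)
    (h : ∀ a τ, V τ (ζ a τ) = ζ' a τ - ζ a τ) :
    AmbientIsotopic (fun a τ => page τ (ζ a τ)) (fun a τ => page τ (ζ' a τ)) := by
  obtain ⟨R, hR⟩ := hV.exists_spaceField_eq_zero
  refine ⟨fun s => hV.displacement s.2, ?_, ?_, ⟨R, ?_⟩, ?_⟩
  · simp only [displacement_apply]
    have := hV.continuous_spaceField
    fun_prop
  · intro x
    simp [displacement_apply]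
  · intro s x hx
    simp [displacement_apply, hR x hx]
  · intro a τ
    rw [displacement_apply, hV.add_spaceField_page _ _ (hre a τ), h]
    simp

end IsPageField

/-! ### Isotopies of closed braids -/

/-- The piecewise linear bump of height `1` at distance `0` that vanishes from distance `ρ` on. -/
noncomputable def bump (ρ d : ℝ) : ℝ := max 0 (1 - d / ρ)

theorem bump_zero (ρ : ℝ) : bump ρ 0 = 1 := by simp [bump]

theorem bump_eq_zero {ρ d : ℝ} (hρ : 0 < ρ) (h : ρ ≤ d) : bump ρ d = 0 := by
  have : 1 ≤ d / ρ := (one_le_div hρ).2 h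
  exact max_eq_left (by linarith)

theorem abs_bump_sub_le {ρ : ℝ} (hρ : 0 < ρ) (d d' : ℝ) :
    |bump ρ d - bump ρ d'| ≤ |d - d'| / ρ := by
  have h := abs_max_sub_max_le_abs (1 - d / ρ) (1 - d' / ρ) 0
  rw [bump, bump, max_comm 0, max_comm 0]
  refine h.trans (le_of_eq ?_)
  rw [show 1 - d / ρ - (1 - d' / ρ) = -((d - d') / ρ) by ring, abs_neg, abs_div, abs_of_pos hρ]

theorem continuous_bump (ρ : ℝ) : Continuous (bump ρ) := by
  unfold bump
  fun_prop

/-- The field that pushes the strands `ζ a (t + j)`, `j < m a`, of a closed braid by the vectors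
`Δ a (t + j)`, with supports in the discs of radius `ρ` around the strands. -/
noncomputable def braidField {c : ℕ} (m : Fin c → ℕ) (ζ Δ : Fin c → ℝ → ℂ) (ρ t : ℝ) (z : ℂ) : ℂ :=
  ∑ a, ∑ j ∈ Finset.range (m a), bump ρ ‖z - ζ a (t + j)‖ • Δ a (t + j)

/-- A sum over the strands of a closed braid does not depend on the page where it starts. -/
theorem periodic_sum_range {g : ℝ → ℂ} {m : ℕ} (hg : Function.Periodic g m) :
    Function.Periodic (fun t => ∑ j ∈ Finset.range m, g (t + j)) 1 := by
  intro t
  have h1 := Finset.sum_range_succ (fun j : ℕ => g (t + j)) m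
  have h2 := Finset.sum_range_succ' (fun j : ℕ => g (t + j)) m
  rw [h1, hg t] at h2
  simp only [Nat.cast_zero, add_zero, Nat.cast_add, Nat.cast_one] at h2
  simp only
  rw [add_right_cancel h2]
  exact Finset.sum_congr rfl fun j _ => by ring_nf

/-- For small vectors `Δ` the sum of all bumps is a contraction, whether or not the discs overlap.
The condition `ρ ≤ 1 / 2` keeps the supports off the axis, which is at distance at least `1` from
the strands. -/
theorem isPageField_braidField {c : ℕ} {m : Fin c → ℕ} {ζ Δ : Fin c → ℝ → ℂ} {ρ η B : ℝ}
    (hζ : ∀ a, Continuous (ζ a)) (hΔ : ∀ a, Continuous (Δ a))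
    (pζ : ∀ a, Function.Periodic (ζ a) (m a)) (pΔ : ∀ a, Function.Periodic (Δ a) (m a))
    (hre : ∀ a τ, 0 ≤ (ζ a τ).re) (hB : ∀ a τ, ‖ζ a τ‖ ≤ B)
    (hρ : 0 < ρ) (hρ' : ρ ≤ 1 / 2) (hη : ∀ a τ, ‖Δ a τ‖ ≤ η) (hη' : (∑ a, m a : ℕ) * η ≤ ρ / 2) :
    IsPageField (braidField m ζ Δ ρ) where
  continuous := by
    unfold braidField
    refine continuous_finsetSum _ fun a _ => continuous_finsetSum _ fun j _ => ?_
    have h1 := hζ a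
    have h2 := hΔ a
    exact ((continuous_bump ρ).comp (by fun_prop)).smul (by fun_prop)
  periodic z := by
    intro t
    refine Finset.sum_congr rfl fun a _ => ?_
    refine periodic_sum_range (g := fun τ => bump ρ ‖z - ζ a τ‖ • Δ a τ) (fun τ => ?_) t
    simp only [pζ a τ, pΔ a τ]
  contracting t z z' := by
    have hterm : ∀ a, ∀ j ∈ Finset.range (m a), ‖bump ρ ‖z - ζ a (t + j)‖ • Δ a (t + j) -
        bump ρ ‖z' - ζ a (t + j)‖ • Δ a (t + j)‖ ≤ ‖z - z'‖ / ρ * η := fun a j _ => by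
      rw [← sub_smul, norm_smul, Real.norm_eq_abs]
      refine mul_le_mul ((abs_bump_sub_le hρ _ _).trans ?_) (hη a _) (norm_nonneg _) (by positivity)
      gcongr
      refine (abs_norm_sub_norm_le _ _).trans (le_of_eq ?_)
      congr 1
      ring
    unfold braidField
    rw [← Finset.sum_sub_distrib]
    simp_rw [← Finset.sum_sub_distrib]
    calc _ ≤ ∑ a, ∑ j ∈ Finset.range (m a), ‖z - z'‖ / ρ * η :=
          (norm_sum_le _ _).trans (Finset.sum_le_sum fun a _ =>
            (norm_sum_le _ _).trans (Finset.sum_le_sum (hterm a)))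
      _ = ‖z - z'‖ / ρ * ((∑ a, m a : ℕ) * η) := by
          simp only [Finset.sum_const, Finset.card_range, nsmul_eq_mul, Nat.cast_sum,
            Finset.sum_mul, Finset.mul_sum]
          exact Finset.sum_congr rfl fun a _ => by ring
      _ ≤ ‖z - z'‖ / ρ * (ρ / 2) := by gcongr
      _ = 1 / 2 * ‖z - z'‖ := by field_simp
  axis t z hz := by
    refine Finset.sum_eq_zero fun a _ => Finset.sum_eq_zero fun j _ => ?_
    have h := Complex.abs_re_le_norm (z - ζ a (t + j))
    rw [Complex.sub_re, abs_sub_comm] at h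
    have h' := hre a (t + j)
    rw [bump_eq_zero hρ (by linarith [le_abs_self ((ζ a (t + j)).re - z.re)]), zero_smul]
  bounded := by
    refine ⟨B + ρ, fun t z hz => ?_⟩
    refine Finset.sum_eq_zero fun a _ => Finset.sum_eq_zero fun j _ => ?_
    have h := norm_sub_norm_le z (ζ a (t + j))
    rw [bump_eq_zero hρ (by linarith [hB a (t + j)]), zero_smul]

/-- If the strands are at distance at least `ρ`, each of them is moved by its own bump only. -/
theorem braidField_strand {c : ℕ} {m : Fin c → ℕ} {ζ : Fin c → ℝ → ℂ} (Δ : Fin c → ℝ → ℂ) {ρ : ℝ}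
    (hm : ∀ a, 0 < m a) (hρ : 0 < ρ)
    (hsep : ∀ a b τ, ∀ j < m b, (a ≠ b ∨ j ≠ 0) → ρ ≤ ‖ζ a τ - ζ b (τ + j)‖) (a : Fin c) (τ : ℝ) :
    braidField m ζ Δ ρ τ (ζ a τ) = Δ a τ := by
  unfold braidField
  rw [Finset.sum_eq_single a, Finset.sum_eq_single 0]
  · simp [bump_zero]
  · intro j hj h0
    rw [bump_eq_zero hρ (hsep a a τ j (Finset.mem_range.1 hj) (Or.inr h0)), zero_smul]
  · intro h
    exact absurd (Finset.mem_range.2 (hm a)) h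
  · intro b _ hb
    refine Finset.sum_eq_zero fun j hj => ?_
    rw [bump_eq_zero hρ (hsep a b τ j (Finset.mem_range.1 hj) (Or.inl hb.symm)), zero_smul]
  · simp

/-- A positive continuous function that is periodic in the second variable is bounded away from
zero over a compact range of the first. -/
theorem exists_pos_le_of_periodic {f : ℝ → ℝ → ℝ} (hf : Continuous (fun p : ℝ × ℝ => f p.1 p.2))
    {T : ℝ} (hT : 0 < T) (hp : ∀ s, Function.Periodic (f s) T)
    (h0 : ∀ s ∈ Icc (0 : ℝ) 1, ∀ τ, 0 < f s τ) : ∃ ρ > 0, ∀ s ∈ Icc (0 : ℝ) 1, ∀ τ, ρ ≤ f s τ := by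
  obtain ⟨x, hx, hmin⟩ := (isCompact_Icc.prod isCompact_Icc :
    IsCompact (Icc (0 : ℝ) 1 ×ˢ Icc 0 T)).exists_isMinOn
    ⟨(0, 0), ⟨by simp, ⟨le_rfl, hT.le⟩⟩⟩ hf.continuousOn
  refine ⟨f x.1 x.2, h0 _ hx.1 _, fun s hs τ => ?_⟩
  obtain ⟨τ', hτ', h⟩ := (hp s).exists_mem_Ico₀ hT τ
  rw [h]
  exact hmin (show (s, τ') ∈ Icc (0 : ℝ) 1 ×ˢ Icc 0 T from ⟨hs, hτ'.1, hτ'.2.le⟩)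

/-- Two closed braids are isotopic if the strands stay disjoint under linear interpolation in the
pages. The interpolation is cut into steps so short, compared with the distances of the strands,
that each of them is the time-one map of a page field. -/
theorem ambientIsotopic_of_interpolation {c : ℕ} {m : Fin c → ℕ} {ζ ζ' : Fin c → ℝ → ℂ} {B : ℝ}
    (hm : ∀ a, 0 < m a)
    (hζ : ∀ a, Continuous (ζ a)) (hζ' : ∀ a, Continuous (ζ' a))
    (pζ : ∀ a, Function.Periodic (ζ a) (m a)) (pζ' : ∀ a, Function.Periodic (ζ' a) (m a))
    (hre : ∀ a τ, 0 ≤ (ζ a τ).re) (hre' : ∀ a τ, 0 ≤ (ζ' a τ).re)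
    (hB : ∀ a τ, ‖ζ a τ‖ ≤ B) (hB' : ∀ a τ, ‖ζ' a τ‖ ≤ B)
    (hne : ∀ s ∈ Icc (0 : ℝ) 1, ∀ a b τ, ∀ j < m b, (a ≠ b ∨ j ≠ 0) →
      ζ a τ + s • (ζ' a τ - ζ a τ) ≠ ζ b (τ + j) + s • (ζ' b (τ + j) - ζ b (τ + j))) :
    AmbientIsotopic (fun a τ => page τ (ζ a τ)) (fun a τ => page τ (ζ' a τ)) := by
  set F : ℝ → Fin c → ℝ → ℂ := fun s a τ => ζ a τ + s • (ζ' a τ - ζ a τ) with hF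
  have pF : ∀ s a, Function.Periodic (F s a) (m a) := fun s a τ => by
    simp only [hF, pζ a τ, pζ' a τ]
  have cF : ∀ a, Continuous (fun p : ℝ × ℝ => F p.1 a p.2) := fun a => by
    have := hζ a
    have := hζ' a
    simp only [hF]
    fun_prop
  -- a common lower bound for the distances of the strands
  have hρ : ∃ ρ > 0, ρ ≤ 1 / 2 ∧ ∀ s ∈ Icc (0 : ℝ) 1, ∀ a b τ, ∀ j < m b, (a ≠ b ∨ j ≠ 0) →
      ρ ≤ ‖F s a τ - F s b (τ + j)‖ := by
    have key : ∀ i : (Fin c × (b : Fin c) × Fin (m b)), ∃ ρ > 0,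
        (i.1 ≠ i.2.1 ∨ (i.2.2 : ℕ) ≠ 0) → ∀ s ∈ Icc (0 : ℝ) 1, ∀ τ,
          ρ ≤ ‖F s i.1 τ - F s i.2.1 (τ + (i.2.2 : ℕ))‖ := by
      rintro ⟨a, b, j⟩
      by_cases h : a ≠ b ∨ (j : ℕ) ≠ 0
      · have hc : Continuous (fun p : ℝ × ℝ => ‖F p.1 a p.2 - F p.1 b (p.2 + (j : ℕ))‖) := by
          have h2 : Continuous (fun p : ℝ × ℝ => F p.1 b (p.2 + (j : ℕ))) :=
            (cF b).comp (by fun_prop : Continuous fun p : ℝ × ℝ => (p.1, p.2 + (j : ℕ)))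
          exact ((cF a).sub h2).norm
        obtain ⟨ρ, hρ, hle⟩ := exists_pos_le_of_periodic
          (f := fun s τ => ‖F s a τ - F s b (τ + (j : ℕ))‖) hc (T := m a * m b)
          (by have := hm a; have := hm b; positivity)
          (fun s τ => by
            have h1 := (pF s a).nat_mul (m b) τ
            have h2 := (pF s b).nat_mul (m a) (τ + (j : ℕ))
            simp only
            rw [mul_comm, h1, mul_comm, add_right_comm, h2])
          (fun s hs τ => norm_pos_iff.2 (sub_ne_zero.2 (hne s hs a b τ j j.2 h)))
        exact ⟨ρ, hρ, fun _ => hle⟩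
      · exact ⟨1, one_pos, fun h' => absurd h' h⟩
    choose r hr hr' using key
    have hev : ∀ᶠ ρ in nhdsWithin (0 : ℝ) (Ioi 0), 0 < ρ ∧ ρ ≤ 1 / 2 ∧ ∀ i, ρ ≤ r i := by
      refine Filter.Eventually.and self_mem_nhdsWithin (Filter.Eventually.and ?_
        (Filter.eventually_all.2 fun i => ?_)) <;>
      exact mem_nhdsWithin_of_mem_nhds (Iic_mem_nhds (by first | exact hr _ | norm_num))
    obtain ⟨ρ, h0, h1, h2⟩ := hev.exists
    exact ⟨ρ, h0, h1, fun s hs a b τ j hj h => (h2 ⟨a, b, j, hj⟩).trans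
      (hr' ⟨a, b, j, hj⟩ h s hs τ)⟩
  obtain ⟨ρ, hρ0, hρ1, hsep⟩ := hρ
  -- a single step moves each strand by at most `2 * B / (n + 1)`
  obtain ⟨n, hn⟩ := exists_nat_gt ((∑ a, m a : ℕ) * (2 * B) / (ρ / 2))
  have hn0 : (0 : ℝ) < n + 1 := by positivity
  have hmem : ∀ q : ℕ, q ≤ n + 1 → (q / (n + 1) : ℝ) ∈ Icc (0 : ℝ) 1 := fun q hq =>
    ⟨by positivity, (div_le_one hn0).2 (mod_cast hq)⟩
  have hFre : ∀ s ∈ Icc (0 : ℝ) 1, ∀ a τ, 0 ≤ (F s a τ).re := fun s hs a τ => by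
    have h1 := mul_nonneg (sub_nonneg.2 hs.2) (hre a τ)
    have h2 := mul_nonneg hs.1 (hre' a τ)
    simp only [hF, Complex.add_re, Complex.real_smul, Complex.re_ofReal_mul, Complex.sub_re]
    linarith
  have hFB : ∀ s ∈ Icc (0 : ℝ) 1, ∀ a τ, ‖F s a τ‖ ≤ B := fun s hs a τ => by
    have : F s a τ = (1 - s) • ζ a τ + s • ζ' a τ := by
      simp only [hF, Complex.real_smul]
      push_cast
      ring
    rw [this]
    refine (norm_add_le _ _).trans ?_
    rw [norm_smul, norm_smul, Real.norm_eq_abs, Real.norm_eq_abs, abs_of_nonneg hs.1,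
      abs_of_nonneg (sub_nonneg.2 hs.2)]
    nlinarith [hB a τ, hB' a τ, hs.1, hs.2]
  have step : ∀ q : ℕ, q ≤ n → AmbientIsotopic (fun a τ => page τ (F (q / (n + 1)) a τ))
      (fun a τ => page τ (F ((q + 1 : ℕ) / (n + 1)) a τ)) := by
    intro q hq
    have hs := hmem q (by omega)
    set Δ : Fin c → ℝ → ℂ := fun a τ => (1 / (n + 1) : ℝ) • (ζ' a τ - ζ a τ) with hΔ
    have hfield : IsPageField (braidField m (F (q / (n + 1))) Δ ρ) := by
      refine isPageField_braidField (η := 1 / (n + 1) * (2 * B)) (B := B)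
        (fun a => (cF a).comp (by fun_prop : Continuous fun τ : ℝ => ((q / (n + 1) : ℝ), τ)))
        (fun a => by have := hζ a; have := hζ' a; simp only [hΔ]; fun_prop) (fun a => pF _ a)
        (fun a τ => by simp only [hΔ, pζ a τ, pζ' a τ]) (hFre _ hs) (hFB _ hs) hρ0 hρ1
        (fun a τ => ?_) ?_
      · simp only [hΔ]
        rw [norm_smul, Real.norm_eq_abs, abs_of_pos (by positivity)]
        gcongr
        linarith [norm_sub_le (ζ' a τ) (ζ a τ), hB a τ, hB' a τ]
      · rw [div_lt_iff₀ (by positivity)] at hn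
        rw [mul_left_comm, one_div, inv_mul_le_iff₀ hn0]
        nlinarith
    refine hfield.ambientIsotopic _ _ (fun a τ => by linarith [hFre _ hs a τ]) fun a τ => ?_
    rw [braidField_strand Δ hm hρ0 (hsep _ hs) a τ]
    simp only [hF, hΔ, Complex.real_smul]
    push_cast
    field_simp
    ring
  have all : ∀ q : ℕ, q ≤ n + 1 → AmbientIsotopic (fun a τ => page τ (F (0 : ℝ) a τ))
      (fun a τ => page τ (F (q / (n + 1)) a τ)) := by
    intro q
    induction q with
    | zero => intro _; simpa using AmbientIsotopic.refl _
    | succ q ih => intro h; exact (ih (by omega)).trans (step q (by omega))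
  have := all (n + 1) le_rfl
  rw [Nat.cast_add, Nat.cast_one, div_self hn0.ne'] at this
  simpa [hF] using this

/-! ### Coordinates in the strips -/

/-- The midpoint of the leaf at time `t` of the left strip (`true`) or the right strip (`false`). -/
noncomputable def center (b : Bool) (t : ℝ) : ℂ :=
  if b then (1 / 4 + merging t / 4 : ℝ) - (merging t * (1 - merging t) : ℝ) * Complex.I
  else (3 / 4 - merging t / 4 : ℝ) + (merging t * (1 - merging t) : ℝ) * Complex.I

/-- The direction of the leaf at time `t` of a strip with `w` half twists. -/
noncomputable def direction (w : ℤ) (t : ℝ) : ℂ :=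
  Complex.exp ((Real.pi * w * twisting t : ℝ) * Complex.I)

/-- The page coordinate of the point of the left strip (`true`) or the right strip (`false`) with
coordinate `s` across the strip at time `t`. -/
noncomputable def spot (u v : ℤ) (b : Bool) (s t : ℝ) : ℂ :=
  center b t + (width t * (s - 1 / 2) : ℝ) * direction (if b then u else v) t

theorem leftStrip_eq (u v : ℤ) (s t : ℝ) : leftStrip u s t = page t (spot u v true s t) := rfl

theorem rightStrip_eq (u v : ℤ) (s t : ℝ) : rightStrip v s t = page t (spot u v false s t) := rfl

theorem norm_direction (w : ℤ) (t : ℝ) : ‖direction w t‖ = 1 :=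
  Complex.norm_exp_ofReal_mul_I _

theorem direction_of_twisting_eq_zero (w : ℤ) {t : ℝ} (ht : twisting t = 0) :
    direction w t = 1 := by
  simp [direction, ht]

theorem direction_of_twisting_eq_one {w : ℤ} (hw : Even w) {t : ℝ} (ht : twisting t = 1) :
    direction w t = 1 := by
  obtain ⟨k, rfl⟩ := hw
  rw [direction, ht]
  have : ((Real.pi * ((k + k : ℤ) : ℝ) * 1 : ℝ) : ℂ) * Complex.I =
      k * (2 * Real.pi * Complex.I) := by
    push_cast
    ring
  rw [this, Complex.exp_int_mul_two_pi_mul_I]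

theorem continuous_merging : Continuous merging := by unfold merging; fun_prop

theorem continuous_twisting : Continuous twisting := by unfold twisting; fun_prop

theorem continuous_width : Continuous width := by
  have := continuous_merging
  unfold width narrowing
  fun_prop

theorem continuous_direction (w : ℤ) : Continuous (direction w) := by
  have := continuous_twisting
  unfold direction
  fun_prop

theorem continuous_center (b : Bool) : Continuous (center b) := by
  have := continuous_merging
  unfold center
  cases b <;> simp <;> fun_prop

theorem continuous_spot (u v : ℤ) (b : Bool) :
    Continuous (fun p : ℝ × ℝ => spot u v b p.1 p.2) := by
  have := continuous_center b
  have := continuous_width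
  have := continuous_direction (if b then u else v)
  unfold spot
  fun_prop

theorem width_pos (t : ℝ) : 0 < width t := by
  have h1 : narrowing t ≤ 1 := min_le_left _ _
  have h2 : 0 ≤ merging t := le_max_left _ _
  unfold width
  linarith

theorem merging_of_le {t : ℝ} (ht : t ≤ 2 / 3) : merging t = 0 := max_eq_left (by linarith)

theorem merging_of_ge {t : ℝ} (ht : 2 / 3 ≤ t) : merging t = 3 * t - 2 := max_eq_right (by linarith)

theorem narrowing_of_ge {t : ℝ} (ht : 1 / 3 ≤ t) : narrowing t = 1 := min_eq_left (by linarith)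

theorem twisting_of_ge {t : ℝ} (ht : 2 / 3 ≤ t) : twisting t = 1 := by
  rw [twisting, min_eq_left (by linarith), max_eq_right zero_le_one]

theorem twisting_zero : twisting 0 = 0 := by
  rw [twisting, min_eq_right (by norm_num), max_eq_left (by norm_num)]

theorem width_le_of_le {t : ℝ} (h0 : 0 ≤ t) (ht : t ≤ 2 / 3) : width t ≤ 1 / 2 := by
  have : 0 ≤ narrowing t := le_min zero_le_one (by linarith)
  rw [width, merging_of_le ht]
  linarith

theorem width_of_ge {t : ℝ} (ht : 2 / 3 ≤ t) : width t = 1 / 4 + 3 / 4 * (3 * t - 2) := by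
  rw [width, merging_of_ge ht, narrowing_of_ge (by linarith)]
  ring

theorem spot_zero (u v : ℤ) (b : Bool) (s : ℝ) :
    spot u v b s 0 = ((if b then s / 2 else (1 + s) / 2 : ℝ) : ℂ) := by
  have h1 : width 0 = 1 / 2 := by
    rw [width, merging_of_le (by norm_num), narrowing, min_eq_right (by norm_num)]; norm_num
  rw [spot, direction_of_twisting_eq_zero _ twisting_zero, h1, center, merging_of_le (by norm_num)]
  cases b <;> simp <;> ring

section Even

variable {u v : ℤ} (hu : Even u) (hv : Even v)
include hu hv

theorem spot_of_ge (b : Bool) (s : ℝ) {t : ℝ} (ht : 2 / 3 ≤ t) :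
    spot u v b s t = center b t + (width t * (s - 1 / 2) : ℝ) := by
  rw [spot, direction_of_twisting_eq_one (by cases b <;> simpa) (twisting_of_ge ht), mul_one]

theorem spot_one (b : Bool) (s : ℝ) : spot u v b s 1 = (s : ℂ) := by
  rw [spot_of_ge hu hv b s (by norm_num), width_of_ge (by norm_num), center,
    merging_of_ge (by norm_num)]
  cases b <;> simp <;> ring

/-- Strictly between the branch line and the branch line the two strips are disjoint. -/
theorem spot_true_ne_spot_false {s s' t : ℝ} (hs : s ∈ Icc (0 : ℝ) 1) (hs' : s' ∈ Icc (0 : ℝ) 1)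
    (ht : t ∈ Ioo (0 : ℝ) 1) : spot u v true s t ≠ spot u v false s' t := by
  intro h
  rcases le_or_gt t (2 / 3) with h23 | h23
  · have hw : width t < 1 / 2 := by
      have : 0 < narrowing t := lt_min zero_lt_one (by linarith [ht.1])
      rw [width, merging_of_le h23]
      linarith
    have hpos := width_pos t
    have h2 : ∀ x ∈ Icc (0 : ℝ) 1, ∀ w : ℤ,
        ‖((width t * (x - 1 / 2) : ℝ) : ℂ) * direction w t‖ ≤ width t / 2 := fun x hx w => by
      rw [norm_mul, norm_direction, mul_one, Complex.norm_real, Real.norm_eq_abs, abs_mul,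
        abs_of_pos hpos]
      have : |x - 1 / 2| ≤ 1 / 2 := abs_le.2 ⟨by linarith [hx.1], by linarith [hx.2]⟩
      nlinarith
    have h3 : ((width t * (s - 1 / 2) : ℝ) : ℂ) * direction u t -
        ((width t * (s' - 1 / 2) : ℝ) : ℂ) * direction v t = ((1 / 2 : ℝ) : ℂ) := by
      simp only [spot, center, merging_of_le h23, if_true] at h
      simp at h
      push_cast
      linear_combination h
    have h4 := norm_sub_le (((width t * (s - 1 / 2) : ℝ) : ℂ) * direction u t)
      (((width t * (s' - 1 / 2) : ℝ) : ℂ) * direction v t)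
    rw [h3, Complex.norm_real, Real.norm_eq_abs, abs_of_pos (by norm_num)] at h4
    linarith [h2 s hs u, h2 s' hs' v]
  · rw [spot_of_ge hu hv true s h23.le, spot_of_ge hu hv false s' h23.le] at h
    have him := congrArg Complex.im h
    simp [center, merging_of_ge h23.le] at him
    nlinarith [ht.2]

end Even

/-- The page coordinates of the template stay in a bounded part of the half-plane. -/
theorem spot_bounds (u v : ℤ) (b : Bool) {s t : ℝ} (hs : s ∈ Icc (0 : ℝ) 1)
    (ht : t ∈ Icc (0 : ℝ) 1) : 0 ≤ (spot u v b s t).re ∧ ‖spot u v b s t‖ ≤ 2 := by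
  have hpos := width_pos t
  have h2 : ‖((width t * (s - 1 / 2) : ℝ) : ℂ) * direction (if b then u else v) t‖
      ≤ width t / 2 := by
    rw [norm_mul, norm_direction, mul_one, Complex.norm_real, Real.norm_eq_abs, abs_mul,
      abs_of_pos hpos]
    have : |s - 1 / 2| ≤ 1 / 2 := abs_le.2 ⟨by linarith [hs.1], by linarith [hs.2]⟩
    nlinarith
  have h3 := (abs_le.1 ((Complex.abs_re_le_norm _).trans h2)).1
  have hm : 0 ≤ merging t ∧ merging t ≤ 1 ∧ width t ≤ 1 / 2 + merging t / 2 := by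
    rcases le_total t (2 / 3) with h | h
    · have := width_le_of_le ht.1 h
      rw [merging_of_le h]
      norm_num
      linarith
    · rw [merging_of_ge h, width_of_ge h]
      refine ⟨by linarith, by linarith [ht.2], by linarith [ht.2]⟩
  obtain ⟨m0, m1, mw⟩ := hm
  have hc : 1 / 4 + merging t / 4 ≤ (center b t).re ∧ (center b t).re ≤ 3 / 4 ∧
      |(center b t).im| ≤ 1 / 4 := by
    have hq : |merging t * (1 - merging t)| ≤ 1 / 4 := by
      rw [abs_le]
      constructor <;> nlinarith [sq_nonneg (merging t - 1 / 2)]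
    cases b
    · simp [center] at hq ⊢
      refine ⟨by linarith, by linarith, by linarith⟩
    · simp [center] at hq ⊢
      refine ⟨by linarith, by linarith⟩
  have hn := Complex.norm_le_abs_re_add_abs_im (center b t)
  rw [abs_of_nonneg (by linarith [hc.1] : 0 ≤ (center b t).re)] at hn
  refine ⟨?_, ?_⟩
  · rw [spot, Complex.add_re]
    linarith [hc.1]
  · refine (norm_add_le _ _).trans ?_
    linarith [hc.2.1, hc.2.2]

/-- The coordinate across the strip of a point with given page coordinate. -/
noncomputable def across (u v : ℤ) (b : Bool) (t : ℝ) (z : ℂ) : ℝ :=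
  ((z - center b t) * (starRingEnd ℂ) (direction (if b then u else v) t)).re / width t + 1 / 2

theorem across_spot (u v : ℤ) (b : Bool) (s t : ℝ) : across u v b t (spot u v b s t) = s := by
  have h : direction (if b then u else v) t *
      (starRingEnd ℂ) (direction (if b then u else v) t) = 1 := by
    rw [Complex.mul_conj, Complex.normSq_eq_norm_sq, norm_direction]
    simp
  rw [across, spot, add_sub_cancel_left, mul_assoc, h, mul_one, Complex.ofReal_re,
    mul_div_cancel_left₀ _ (width_pos t).ne']
  ring

theorem spot_interpolation (u v : ℤ) (b : Bool) (s s' t r : ℝ) :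
    spot u v b s t + r • (spot u v b s' t - spot u v b s t) =
      spot u v b (s + r * (s' - s)) t := by
  simp only [spot, Complex.real_smul]
  push_cast
  ring

/-- The page coordinate of a point of the page `t`. -/
noncomputable def pageCoord (t : ℝ) (x : E3) : ℂ :=
  ⟨x 0 * Real.cos (2 * Real.pi * t) + x 1 * Real.sin (2 * Real.pi * t) - 1, x 2⟩

theorem pageCoord_page (t : ℝ) (z : ℂ) : pageCoord t (page t z) = z := by
  apply Complex.ext
  · simp only [pageCoord, page, PiLp.toLp_apply]
    simp
    linear_combination (1 + z.re) * Real.sin_sq_add_cos_sq (2 * Real.pi * t)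
  · simp [pageCoord, page]

theorem continuous_pageCoord : Continuous (fun p : ℝ × E3 => pageCoord p.1 p.2) := by
  have : (fun p : ℝ × E3 => pageCoord p.1 p.2) = fun p : ℝ × E3 =>
      ((p.2 0 * Real.cos (2 * Real.pi * p.1) + p.2 1 * Real.sin (2 * Real.pi * p.1) - 1 : ℝ) : ℂ) +
        (p.2 2 : ℝ) * Complex.I := by
    funext p
    apply Complex.ext
    · rw [Complex.add_re, Complex.ofReal_re, Complex.re_ofReal_mul]
      simp [pageCoord]
    · rw [Complex.add_im, Complex.ofReal_im, Complex.im_ofReal_mul]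
      simp [pageCoord]
  rw [this]
  fun_prop

theorem pageCoord_add_nat (t : ℝ) (k : ℕ) (x : E3) : pageCoord (t + k) x = pageCoord t x := by
  have h : 2 * Real.pi * (t + k) = 2 * Real.pi * t + k * (2 * Real.pi) := by ring
  simp only [pageCoord, h, Real.cos_add_nat_mul_two_pi, Real.sin_add_nat_mul_two_pi]

/-! ### The order of the strands on the branch line -/

/-- `L` is a link in the template whose component `a` makes its turn number `N` in the left strip
if `word a N` is `true`, and in the right strip otherwise. -/
structure IsCodedLink (u v : ℤ) {c : ℕ} (m : Fin c → ℕ) (word : Fin c → ℕ → Bool)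
    (L : Fin c → ℝ → E3) : Prop where
  link : IsLorenzLikeLink u v m L
  word_periodic : ∀ a, Function.Periodic (word a) (m a)
  mem : ∀ a (N : ℕ), ∀ t ∈ Icc (0 : ℝ) 1, ∃ s ∈ Icc (0 : ℝ) 1,
    L a (N + t) = page t (spot u v (word a N) s t)

/-- The page coordinates of a closed braid. -/
noncomputable def coord {c : ℕ} (L : Fin c → ℝ → E3) (a : Fin c) (τ : ℝ) : ℂ :=
  pageCoord τ (L a τ)

/-- The coordinate across its strip of the turn number `N` of the component `a`. -/
noncomputable def turnCoord (u v : ℤ) {c : ℕ} (word : Fin c → ℕ → Bool) (L : Fin c → ℝ → E3)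
    (a : Fin c) (N : ℕ) (t : ℝ) : ℝ :=
  across u v (word a N) t (coord L a (N + t))

/-- The point of the branch line where the turn number `N` of the component `a` starts. -/
noncomputable def pos {c : ℕ} (L : Fin c → ℝ → E3) (a : Fin c) (N : ℕ) : ℝ := (coord L a N).re

/-- Any time can be moved by a multiple of a period to a nonnegative one. -/
theorem exists_nat_add_eq {T : ℝ} (hT : 0 < T) (τ : ℝ) : ∃ (N : ℕ) (t : ℝ), t ∈ Ico (0 : ℝ) 1 ∧
    ∃ k : ℤ, τ + k * T = N + t := by
  obtain ⟨k, ⟨h0, -⟩, -⟩ := existsUnique_add_zsmul_mem_Ico hT τ 0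
  refine ⟨⌊τ + k • T⌋₊, τ + k • T - ⌊τ + k • T⌋₊, ⟨?_, ?_⟩, k, ?_⟩
  · linarith [Nat.floor_le h0]
  · linarith [Nat.lt_floor_add_one (τ + k • T)]
  · rw [zsmul_eq_mul]
    ring

namespace IsCodedLink

variable {u v : ℤ} {c : ℕ} {m : Fin c → ℕ} {word : Fin c → ℕ → Bool} {L : Fin c → ℝ → E3}

section

variable (h : IsCodedLink u v m word L)
include h

theorem continuous_coord (a : Fin c) : Continuous (coord L a) :=
  continuous_pageCoord.comp (continuous_id.prodMk (h.link.continuous a))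

theorem periodic_coord (a : Fin c) : Function.Periodic (coord L a) (m a) := fun τ => by
  rw [coord, h.link.periodic a τ, pageCoord_add_nat, coord]

theorem turnCoord_spec (a : Fin c) (N : ℕ) {t : ℝ} (ht : t ∈ Icc (0 : ℝ) 1) :
    turnCoord u v word L a N t ∈ Icc (0 : ℝ) 1 ∧
      coord L a (N + t) = spot u v (word a N) (turnCoord u v word L a N t) t ∧
      L a (N + t) = page t (coord L a (N + t)) := by
  obtain ⟨s, hs, hL⟩ := h.mem a N t ht
  have hc : coord L a (N + t) = spot u v (word a N) s t := by
    rw [coord, add_comm (N : ℝ) t, pageCoord_add_nat, add_comm t (N : ℝ), hL, pageCoord_page]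
  have hs' : turnCoord u v word L a N t = s := by rw [turnCoord, hc, across_spot]
  exact ⟨hs' ▸ hs, by rw [hs', hc], by rw [hc, hL]⟩

theorem continuous_turnCoord (a : Fin c) (N : ℕ) : Continuous (turnCoord u v word L a N) := by
  have h1 := h.continuous_coord a
  have h2 := continuous_center (word a N)
  have h3 := continuous_direction (if word a N then u else v)
  unfold turnCoord across
  refine Continuous.add (Continuous.div₀ ?_ continuous_width fun t => (width_pos t).ne')
    continuous_const
  refine Complex.continuous_re.comp (Continuous.mul (by fun_prop) ?_)
  exact Complex.continuous_conj.comp h3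

theorem coord_nat (a : Fin c) (N : ℕ) : coord L a N = (pos L a N : ℂ) := by
  have h1 := (h.turnCoord_spec a N (left_mem_Icc.2 zero_le_one)).2.1
  rw [add_zero, spot_zero] at h1
  rw [pos, h1, Complex.ofReal_re]

theorem pos_eq (a : Fin c) (N : ℕ) : pos L a N =
    if word a N then turnCoord u v word L a N 0 / 2 else (1 + turnCoord u v word L a N 0) / 2 := by
  have h1 := (h.turnCoord_spec a N (left_mem_Icc.2 zero_le_one)).2.1
  rw [add_zero, spot_zero] at h1
  rw [pos, h1, Complex.ofReal_re]

theorem pos_succ_eq (hu : Even u) (hv : Even v) (a : Fin c) (N : ℕ) :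
    pos L a (N + 1) = turnCoord u v word L a N 1 := by
  have h1 := (h.turnCoord_spec a N (right_mem_Icc.2 zero_le_one)).2.1
  rw [spot_one hu hv] at h1
  rw [pos, Nat.cast_add, Nat.cast_one, h1, Complex.ofReal_re]

/-- Embeddedness in page coordinates: strands that meet are the same strand of the same
component. -/
theorem eq_of_coord_eq {a b : Fin c} {N N' : ℕ} {t : ℝ} (ht : t ∈ Icc (0 : ℝ) 1)
    (he : coord L a (N + t) = coord L b (N' + t)) : a = b ∧ ∃ q : ℤ, (N' : ℤ) = N + q * m a := by
  have h1 := (h.turnCoord_spec a N ht).2.2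
  have h2 := (h.turnCoord_spec b N' ht).2.2
  obtain ⟨hab, q, hq⟩ := h.link.embedded a b (N + t) (N' + t) (by rw [h1, h2, he])
  refine ⟨hab, q, ?_⟩
  have : (N' : ℝ) = N + q * m a := by linarith
  exact_mod_cast this

theorem eq_of_pos_eq {a b : Fin c} {N N' : ℕ} (he : pos L a N = pos L b N') :
    a = b ∧ ∃ q : ℤ, (N' : ℤ) = N + q * m a := by
  refine h.eq_of_coord_eq (left_mem_Icc.2 zero_le_one) ?_
  rw [add_zero, add_zero, h.coord_nat, h.coord_nat, he]

theorem pos_eq_of_eq {a : Fin c} {N N' : ℕ} {q : ℤ} (hq : (N' : ℤ) = N + q * m a) :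
    pos L a N' = pos L a N := by
  have : (N' : ℝ) = N + q * m a := by exact_mod_cast hq
  rw [pos, this, (h.periodic_coord a).int_mul q, pos]

theorem word_eq_of_eq {a : Fin c} {N N' : ℕ} {q : ℤ} (hq : (N' : ℤ) = N + q * m a) :
    word a N' = word a N := by
  rcases le_total 0 q with h0 | h0
  · obtain ⟨k, rfl⟩ := Int.eq_ofNat_of_zero_le h0
    have : N' = N + k * m a := by exact_mod_cast hq
    rw [this, ← smul_eq_mul, (h.word_periodic a).nsmul k]
  · obtain ⟨k, hk⟩ := Int.eq_ofNat_of_zero_le (neg_nonneg.2 h0)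
    obtain rfl : q = -k := by omega
    have : N = N' + k * m a := by
      zify
      linarith
    rw [this, ← smul_eq_mul, (h.word_periodic a).nsmul k]

theorem pos_lt_of_word {a b : Fin c} {N N' : ℕ} (ha : word a N = true) (hb : word b N' = false) :
    pos L a N < pos L b N' := by
  refine lt_of_le_of_ne ?_ fun he => ?_
  · have h1 := (h.turnCoord_spec a N (left_mem_Icc.2 zero_le_one)).1.2
    have h2 := (h.turnCoord_spec b N' (left_mem_Icc.2 zero_le_one)).1.1
    rw [h.pos_eq, h.pos_eq, ha, hb]
    simp
    linarith
  · obtain ⟨rfl, q, hq⟩ := h.eq_of_pos_eq he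
    rw [h.word_eq_of_eq hq, ha] at hb
    exact absurd hb (by simp)

/-- The order of two strands does not change while they run through the same strip. -/
theorem turnCoord_lt {a b : Fin c} {N N' : ℕ} (hw : word a N = word b N')
    (hp : pos L a N < pos L b N') {t : ℝ} (ht : t ∈ Icc (0 : ℝ) 1) :
    turnCoord u v word L a N t < turnCoord u v word L b N' t := by
  have h0 : turnCoord u v word L a N 0 < turnCoord u v word L b N' 0 := by
    rw [h.pos_eq, h.pos_eq, hw] at hp
    split_ifs at hp <;> linarith
  by_contra! hle
  obtain ⟨r, hr, he⟩ := isPreconnected_Icc.intermediate_value₂ (left_mem_Icc.2 zero_le_one) ht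
    (h.continuous_turnCoord a N).continuousOn (h.continuous_turnCoord b N').continuousOn h0.le hle
  have hc : coord L a (N + r) = coord L b (N' + r) := by
    rw [(h.turnCoord_spec a N hr).2.1, (h.turnCoord_spec b N' hr).2.1, he, hw]
  obtain ⟨rfl, q, hq⟩ := h.eq_of_coord_eq hr hc
  exact hp.ne (h.pos_eq_of_eq hq).symm

theorem pos_succ_lt (hu : Even u) (hv : Even v) {a b : Fin c} {N N' : ℕ}
    (hw : word a N = word b N') (hp : pos L a N < pos L b N') :
    pos L a (N + 1) < pos L b (N' + 1) := by
  rw [h.pos_succ_eq hu hv, h.pos_succ_eq hu hv]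
  exact h.turnCoord_lt hw hp (right_mem_Icc.2 zero_le_one)

theorem pos_succ_lt_iff (hu : Even u) (hv : Even v) {a b : Fin c} {N N' : ℕ}
    (hw : word a N = word b N') :
    pos L a (N + 1) < pos L b (N' + 1) ↔ pos L a N < pos L b N' := by
  refine ⟨fun hp => ?_, h.pos_succ_lt hu hv hw⟩
  rcases lt_trichotomy (pos L a N) (pos L b N') with h1 | h1 | h1
  · exact h1
  · obtain ⟨rfl, q, hq⟩ := h.eq_of_pos_eq h1
    exact absurd (h.pos_eq_of_eq (N := N + 1) (N' := N' + 1) (q := q) (by push_cast; linarith))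
      hp.ne'
  · exact absurd (h.pos_succ_lt hu hv hw.symm h1) hp.asymm

theorem pos_add_lt_iff (hu : Even u) (hv : Even v) {a b : Fin c} {N N' : ℕ} (n : ℕ)
    (hw : ∀ q < n, word a (N + q) = word b (N' + q)) :
    pos L a (N + n) < pos L b (N' + n) ↔ pos L a N < pos L b N' := by
  induction n with
  | zero => rfl
  | succ n ih =>
    rw [← add_assoc, ← add_assoc, h.pos_succ_lt_iff hu hv (hw n n.lt_succ_self)]
    exact ih fun q hq => hw q (hq.trans n.lt_succ_self)

/-- The words of the components of an embedded link are not proper powers: a strand that precedes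
a shift of itself would precede itself after finitely many shifts. -/
theorem eq_of_itinerary (hu : Even u) (hv : Even v) {a : Fin c} {N N' : ℕ}
    (hw : ∀ n, word a (N + n) = word a (N' + n)) : ∃ q : ℤ, (N' : ℤ) = N + q * m a := by
  wlog hle : N ≤ N' generalizing N N'
  · obtain ⟨q, hq⟩ := this (fun n => (hw n).symm) (le_of_not_ge hle)
    exact ⟨-q, by linarith⟩
  obtain ⟨e, rfl⟩ := Nat.exists_eq_add_of_le hle
  have hper : pos L a (N + m a * e) = pos L a N :=
    h.pos_eq_of_eq (q := e) (by push_cast; ring)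
  have hm : 0 < m a := h.link.period_pos a
  have hshift : ∀ k, N + e + k * e = N + (k + 1) * e := fun k => by ring
  rcases lt_trichotomy (pos L a N) (pos L a (N + e)) with h1 | h1 | h1
  · have hlt : StrictMono fun k : ℕ => pos L a (N + k * e) := by
      refine strictMono_nat_of_lt_succ fun k => ?_
      rw [← hshift k]
      exact (h.pos_add_lt_iff hu hv (k * e) fun q _ => hw q).2 h1
    have := hlt hm
    simp [hper] at this
  · exact (h.eq_of_pos_eq h1).2
  · have hlt : StrictAnti fun k : ℕ => pos L a (N + k * e) := by
      refine strictAnti_nat_of_succ_lt fun k => ?_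
      rw [← hshift k]
      exact (h.pos_add_lt_iff hu hv (k * e) fun q _ => (hw q).symm).2 h1
    have := hlt hm
    simp [hper] at this

/-- Any time can be moved by a common period of all components to a nonnegative one. -/
theorem exists_turn (τ : ℝ) : ∃ (N : ℕ) (t : ℝ), t ∈ Ico (0 : ℝ) 1 ∧
    ∃ k : ℤ, τ + k * (∏ a, m a : ℕ) = N + t :=
  exists_nat_add_eq (by exact_mod_cast Finset.prod_pos fun a _ => h.link.period_pos a) τ

theorem coord_add_prod (a : Fin c) (k : ℤ) (τ : ℝ) :
    coord L a (τ + k * (∏ a, m a : ℕ)) = coord L a τ := by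
  obtain ⟨r, hr⟩ := Finset.dvd_prod_of_mem m (Finset.mem_univ a)
  have := (h.periodic_coord a).int_mul (k * r) τ
  rw [← this]
  congr 2
  rw [hr]
  push_cast
  ring

theorem page_coord (a : Fin c) (τ : ℝ) : page τ (coord L a τ) = L a τ := by
  obtain ⟨N, t, ht, k, hk⟩ := h.exists_turn τ
  obtain ⟨r, hr⟩ := Finset.dvd_prod_of_mem m (Finset.mem_univ a)
  have hL : L a (τ + k * (∏ a, m a : ℕ)) = L a τ := by
    have := (h.link.periodic a).int_mul (k * r) τ
    rw [← this]
    congr 2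
    rw [hr]
    push_cast
    ring
  have h1 := (h.turnCoord_spec a N ⟨ht.1, ht.2.le⟩).2.2
  rw [← hk, hL, h.coord_add_prod] at h1
  rw [h1]
  have h2 : τ = t + ((N - k * (∏ a, m a : ℕ) : ℤ) : ℝ) := by
    push_cast at hk ⊢
    linarith
  conv_lhs => rw [h2, page_add_int]
  rw [← h2]

theorem coord_bounds (a : Fin c) (τ : ℝ) : 0 ≤ (coord L a τ).re ∧ ‖coord L a τ‖ ≤ 2 := by
  obtain ⟨N, t, ht, k, hk⟩ := h.exists_turn τ
  obtain ⟨h1, h2, -⟩ := h.turnCoord_spec a N ⟨ht.1, ht.2.le⟩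
  rw [← h.coord_add_prod a k τ, hk, h2]
  exact spot_bounds u v _ h1 ⟨ht.1, ht.2.le⟩

end

/-- Two links with the same words and the same order of the strands on the branch line are
isotopic: the strands stay disjoint under linear interpolation, as it keeps their order in the
strips. -/
theorem ambientIsotopic_of_pos {L' : Fin c → ℝ → E3} (hu : Even u) (hv : Even v)
    (h : IsCodedLink u v m word L) (h' : IsCodedLink u v m word L')
    (hpos : ∀ a b N N', pos L a N < pos L b N' → pos L' a N < pos L' b N') :
    AmbientIsotopic L L' := by
  have key := ambientIsotopic_of_interpolation (ζ := coord L) (ζ' := coord L')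
    h.link.period_pos h.continuous_coord h'.continuous_coord h.periodic_coord h'.periodic_coord
    (fun a τ => (h.coord_bounds a τ).1) (fun a τ => (h'.coord_bounds a τ).1)
    (fun a τ => (h.coord_bounds a τ).2) (fun a τ => (h'.coord_bounds a τ).2) ?_
  · simpa only [h.page_coord, h'.page_coord] using key
  intro r hr a b τ j hj hne he
  obtain ⟨N, t, ht, k, hk⟩ := h.exists_turn τ
  have ht' : t ∈ Icc (0 : ℝ) 1 := ⟨ht.1, ht.2.le⟩
  have hk' : τ + j + k * (∏ a, m a : ℕ) = (N + j : ℕ) + t := by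
    push_cast at hk ⊢
    linarith
  rw [← h.coord_add_prod a k, ← h'.coord_add_prod a k, ← h.coord_add_prod b k,
    ← h'.coord_add_prod b k, hk, hk'] at he
  have hdist : pos L a N ≠ pos L b (N + j) := fun hp => by
    obtain ⟨rfl, q, hq⟩ := h.eq_of_pos_eq hp
    have hj0 : (j : ℤ) = q * m a := by push_cast at hq; linarith
    have hdvd : (m a : ℤ) ∣ j := ⟨q, by rw [hj0]; ring⟩
    have := Nat.eq_zero_of_dvd_of_lt (Int.natCast_dvd_natCast.1 hdvd) hj
    simp [this] at hne
  obtain ⟨sa, ea, -⟩ := h.turnCoord_spec a N ht'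
  obtain ⟨sa', ea', -⟩ := h'.turnCoord_spec a N ht'
  obtain ⟨sb, eb, -⟩ := h.turnCoord_spec b (N + j) ht'
  obtain ⟨sb', eb', -⟩ := h'.turnCoord_spec b (N + j) ht'
  have conv : ∀ x ∈ Icc (0 : ℝ) 1, ∀ y ∈ Icc (0 : ℝ) 1, x + r * (y - x) ∈ Icc (0 : ℝ) 1 :=
    fun x hx y hy => ⟨by nlinarith [hx.1, hy.1, hr.1, hr.2], by nlinarith [hx.2, hy.2, hr.1, hr.2]⟩
  have mono : ∀ {x y x' y' : ℝ}, x < x' → y < y' → x + r * (y - x) ≠ x' + r * (y' - x') := by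
    intro x y x' y' hx hy
    have h1 := mul_nonneg hr.1 (sub_nonneg.2 hy.le)
    have h2 := mul_nonneg (sub_nonneg.2 hr.2) (sub_nonneg.2 hx.le)
    rcases hr.1.eq_or_lt with h0 | h0
    · rw [← h0]
      linarith
    · have := mul_pos h0 (sub_pos.2 hy)
      intro h3
      nlinarith
  by_cases hw : word a N = word b (N + j)
  · rw [ea, ea', eb, eb', spot_interpolation, spot_interpolation, hw] at he
    have hs := congrArg (across u v (word b (N + j)) t) he
    rw [across_spot, across_spot] at hs
    rcases lt_or_gt_of_ne hdist with hlt | hlt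
    · exact mono (h.turnCoord_lt hw hlt ht') (h'.turnCoord_lt hw (hpos _ _ _ _ hlt) ht') hs
    · exact mono (h.turnCoord_lt hw.symm hlt ht')
        (h'.turnCoord_lt hw.symm (hpos _ _ _ _ hlt) ht') hs.symm
  · rcases ht.1.eq_or_lt with h0 | h0
    · -- on the branch line the order of the points decides
      rw [← h0, add_zero, add_zero, h.coord_nat, h'.coord_nat, h.coord_nat, h'.coord_nat] at he
      simp only [Complex.real_smul] at he
      have hs : pos L a N + r * (pos L' a N - pos L a N) =
          pos L b (N + j) + r * (pos L' b (N + j) - pos L b (N + j)) := by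
        exact_mod_cast he
      rcases lt_or_gt_of_ne hdist with hlt | hlt
      · exact mono hlt (hpos _ _ _ _ hlt) hs
      · exact mono hlt (hpos _ _ _ _ hlt) hs.symm
    · rw [ea, ea', eb, eb', spot_interpolation, spot_interpolation] at he
      cases hwa : word a N <;> cases hwb : word b (N + j)
      · simp [hwa, hwb] at hw
      · rw [hwa, hwb] at he
        exact spot_true_ne_spot_false hu hv (conv _ sb _ sb') (conv _ sa _ sa') ⟨h0, ht.2⟩ he.symm
      · rw [hwa, hwb] at he
        exact spot_true_ne_spot_false hu hv (conv _ sa _ sa') (conv _ sb _ sb') ⟨h0, ht.2⟩ he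
      · simp [hwa, hwb] at hw

/-- Two links with the same words are isotopic if they agree in the order of the strands that
have the same itinerary; the order of the other strands is determined by the words. -/
theorem ambientIsotopic_of_parallel {L' : Fin c → ℝ → E3} (hu : Even u) (hv : Even v)
    (h : IsCodedLink u v m word L) (h' : IsCodedLink u v m word L')
    (hpar : ∀ a b N N', a ≠ b → (∀ n, word a (N + n) = word b (N' + n)) →
      pos L a N < pos L b N' → pos L' a N < pos L' b N') :
    AmbientIsotopic L L' := by
  refine ambientIsotopic_of_pos hu hv h h' fun a b N N' hlt => ?_
  by_cases hw : ∀ n, word a (N + n) = word b (N' + n)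
  · rcases eq_or_ne a b with rfl | hab
    · obtain ⟨q, hq⟩ := h.eq_of_itinerary hu hv hw
      exact absurd (h.pos_eq_of_eq hq) hlt.ne'
    · exact hpar a b N N' hab hw hlt
  · push Not at hw
    classical
    have hmin : ∀ q < Nat.find hw, word a (N + q) = word b (N' + q) := fun q hq => by
      simpa using Nat.find_min hw hq
    have hn := Nat.find_spec hw
    rw [← h.pos_add_lt_iff hu hv _ hmin] at hlt
    rw [← h'.pos_add_lt_iff hu hv _ hmin]
    cases hwa : word a (N + Nat.find hw) <;> cases hwb : word b (N' + Nat.find hw)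
    · simp [hwa, hwb] at hn
    · exact absurd hlt (h.pos_lt_of_word hwb hwa).asymm
    · exact h'.pos_lt_of_word hwa hwb
    · simp [hwa, hwb] at hn

end IsCodedLink

namespace CodeWords

variable {c : ℕ} (W : CodeWords c)

/-! ### The letters of the code words -/

theorem yStart_eq (a : Fin c) (j : ℕ) : W.yStart a j = W.xStart a j + W.k a j := rfl

theorem xStart_succ (a : Fin c) (j : ℕ) : W.xStart a (j + 1) = W.yStart a j + W.l a j := by
  rw [xStart, Finset.sum_range_succ, yStart, xStart, add_assoc]

theorem xStart_zero (a : Fin c) : W.xStart a 0 = 0 := rfl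

theorem strictMono_xStart (a : Fin c) : StrictMono (W.xStart a) := by
  refine strictMono_nat_of_lt_succ fun j => ?_
  have := W.k_pos a j
  rw [xStart_succ, yStart_eq]
  omega

/-- The number of complete subwords `x ^ k * y ^ l` before the letter number `N`. -/
def block (a : Fin c) (N : ℕ) : ℕ := Nat.findGreatest (fun j => W.xStart a j ≤ N) N

theorem block_eq {a : Fin c} {N j : ℕ} (h1 : W.xStart a j ≤ N) (h2 : N < W.xStart a (j + 1)) :
    W.block a N = j := by
  have hj : j ≤ N := ((W.strictMono_xStart a).id_le j).trans h1
  refine le_antisymm ?_ (Nat.le_findGreatest hj h1)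
  have h3 : W.xStart a (W.block a N) ≤ N :=
    Nat.findGreatest_spec (P := fun j => W.xStart a j ≤ N) hj h1
  exact Nat.lt_succ_iff.1 ((W.strictMono_xStart a).lt_iff_lt.1 (h3.trans_lt h2))

/-- The letter number `N` of the periodic word of the component `a`: `true` is `x`, `false`
is `y`. -/
def letter (a : Fin c) (N : ℕ) : Bool := decide (N < W.yStart a (W.block a N))

theorem block_x {a : Fin c} {j r : ℕ} (hr : r < W.k a j) : W.block a (W.xStart a j + r) = j := by
  refine W.block_eq (Nat.le_add_right _ _) ?_
  rw [xStart_succ, yStart_eq]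
  omega

theorem block_y {a : Fin c} {j r : ℕ} (hr : r < W.l a j) : W.block a (W.yStart a j + r) = j := by
  refine W.block_eq ?_ ?_
  · rw [yStart_eq]
    omega
  · rw [xStart_succ]
    omega

theorem letter_x {a : Fin c} {j r : ℕ} (hr : r < W.k a j) :
    W.letter a (W.xStart a j + r) = true := by
  rw [letter, W.block_x hr, yStart_eq]
  simpa using hr

theorem letter_y {a : Fin c} {j r : ℕ} (hr : r < W.l a j) :
    W.letter a (W.yStart a j + r) = false := by
  rw [letter, W.block_y hr]
  simp

theorem exists_block (a : Fin c) (N : ℕ) : ∃ j, W.xStart a j ≤ N ∧ N < W.xStart a (j + 1) := by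
  refine ⟨W.block a N,
    Nat.findGreatest_spec (P := fun j => W.xStart a j ≤ N) (Nat.zero_le N) (Nat.zero_le N), ?_⟩
  by_contra! h
  have := Nat.le_findGreatest (P := fun j => W.xStart a j ≤ N)
    (((W.strictMono_xStart a).id_le _).trans h) h
  exact absurd this (Nat.not_succ_le_self _)

/-- Every letter is in one of the powers of `x` or in one of the powers of `y`; it is located by
the number of letters of that power to go, itself included. -/
theorem exists_index (a : Fin c) (N : ℕ) :
    (∃ j q, 1 ≤ q ∧ q ≤ W.k a j ∧ N = W.xStart a j + (W.k a j - q)) ∨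
    (∃ j q, 1 ≤ q ∧ q ≤ W.l a j ∧ N = W.yStart a j + (W.l a j - q)) := by
  obtain ⟨j, h1, h2⟩ := W.exists_block a N
  rw [xStart_succ] at h2
  rcases lt_or_ge N (W.yStart a j) with h | h
  · refine Or.inl ⟨j, W.yStart a j - N, ?_⟩
    rw [yStart_eq] at h ⊢
    omega
  · exact Or.inr ⟨j, W.yStart a j + W.l a j - N, by omega⟩

/-- The exponents from the index `j` on of the component `a` are those from the index `i` on of
the component `b`. -/
def Agree (a : Fin c) (j : ℕ) (b : Fin c) (i : ℕ) : Prop :=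
  ∀ q, W.k a (j + q) = W.k b (i + q) ∧ W.l a (j + q) = W.l b (i + q)

variable {W}

theorem Agree.symm {a b : Fin c} {j i : ℕ} (h : W.Agree a j b i) : W.Agree b i a j :=
  fun q => ⟨(h q).1.symm, (h q).2.symm⟩

theorem Agree.trans {a b d : Fin c} {j i r : ℕ} (h : W.Agree a j b i) (h' : W.Agree b i d r) :
    W.Agree a j d r :=
  fun q => ⟨(h q).1.trans (h' q).1, (h q).2.trans (h' q).2⟩

theorem Agree.add {a b : Fin c} {j i : ℕ} (h : W.Agree a j b i) (r : ℕ) :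
    W.Agree a (j + r) b (i + r) := fun q => by
  rw [add_assoc, add_assoc]
  exact h (r + q)

variable (W)

theorem k_add_mul (a : Fin c) (j r : ℕ) : W.k a (j + r * W.n a) = W.k a j := by
  have h : Function.Periodic (W.k a) (W.n a) := W.k_periodic a
  rw [← smul_eq_mul, h.nsmul r]

theorem l_add_mul (a : Fin c) (j r : ℕ) : W.l a (j + r * W.n a) = W.l a j := by
  have h : Function.Periodic (W.l a) (W.n a) := W.l_periodic a
  rw [← smul_eq_mul, h.nsmul r]

theorem agree_add_mul (a : Fin c) (j r : ℕ) : W.Agree a (j + r * W.n a) a j := fun q => by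
  rw [add_right_comm]
  exact ⟨W.k_add_mul a _ r, W.l_add_mul a _ r⟩

theorem agree_mod (a : Fin c) (j : ℕ) : W.Agree a j a (j % W.n a) := by
  have := W.agree_add_mul a (j % W.n a) (j / W.n a)
  rwa [mul_comm, Nat.mod_add_div] at this

variable {W}

/-- The exponents are periodic, so they agree everywhere if they agree eventually. -/
theorem Agree.of_add {a b : Fin c} {j i r : ℕ} (h : W.Agree a (j + r) b (i + r)) :
    W.Agree a j b i := by
  have hp := Nat.mul_pos (W.n_pos a) (W.n_pos b)
  obtain ⟨e, he⟩ : ∃ e, r * (W.n a * W.n b) = r + e :=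
    Nat.exists_eq_add_of_le (Nat.le_mul_of_pos_right r hp)
  have h1 := h.add e
  rw [add_assoc, add_assoc, ← he] at h1
  have h2 := W.agree_add_mul a j (r * W.n b)
  have h3 := W.agree_add_mul b i (r * W.n a)
  rw [show r * W.n b * W.n a = r * (W.n a * W.n b) by ring] at h2
  rw [show r * W.n a * W.n b = r * (W.n a * W.n b) by ring] at h3
  exact h2.symm.trans (h1.trans h3)

theorem Agree.xStart_add {a b : Fin c} {j i : ℕ} (h : W.Agree a j b i) (q : ℕ) :
    W.xStart a (j + q) + W.xStart b i = W.xStart b (i + q) + W.xStart a j := by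
  induction q with
  | zero => simp [add_comm]
  | succ q ih =>
    rw [← add_assoc, ← add_assoc, xStart_succ, xStart_succ, yStart_eq, yStart_eq, (h q).1, (h q).2]
    omega

/-- Where the exponents agree, the letters agree. -/
theorem Agree.letter {a b : Fin c} {j i : ℕ} (h : W.Agree a j b i) (N : ℕ) :
    W.letter a (W.xStart a j + N) = W.letter b (W.xStart b i + N) := by
  obtain ⟨p, h1, h2⟩ := W.exists_block a (W.xStart a j + N)
  have hp : j ≤ p := by
    by_contra! hlt
    have := (W.strictMono_xStart a).monotone (Nat.succ_le_of_lt hlt)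
    simp only [Nat.succ_eq_add_one] at this
    omega
  obtain ⟨q, rfl⟩ := Nat.exists_eq_add_of_le hp
  have e1 := h.xStart_add q
  rw [xStart_succ, yStart_eq, (h q).1, (h q).2] at h2
  obtain ⟨r, hr⟩ := Nat.exists_eq_add_of_le h1
  have hr' : W.xStart b i + N = W.xStart b (i + q) + r := by omega
  rw [hr, hr']
  rcases lt_or_ge r (W.k b (i + q)) with hlt | hge
  · rw [W.letter_x hlt, W.letter_x (by rwa [(h q).1])]
  · obtain ⟨s, rfl⟩ := Nat.exists_eq_add_of_le hge
    have hs : s < W.l b (i + q) := by omega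
    rw [← add_assoc, ← add_assoc, ← yStart_eq, W.letter_y hs, ← (h q).1, ← yStart_eq,
      W.letter_y (by rwa [(h q).2])]

variable (W)

/-- The first powers of two words with the same letters have the same exponents. -/
theorem exponents_eq_of_letter {a b : Fin c} {j i : ℕ}
    (h : ∀ N, W.letter a (W.xStart a j + N) = W.letter b (W.xStart b i + N)) :
    W.k a j = W.k b i ∧ W.l a j = W.l b i := by
  have hx : ∀ d : Fin c, ∀ p, W.letter d (W.xStart d p + W.k d p) = false := fun d p => by
    simpa [yStart_eq] using W.letter_y (r := 0) (W.l_pos d p)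
  have hy : ∀ d : Fin c, ∀ p, W.letter d (W.xStart d p + (W.k d p + W.l d p)) = true :=
    fun d p => by
      rw [← add_assoc, ← yStart_eq, ← xStart_succ]
      simpa using W.letter_x (r := 0) (W.k_pos d (p + 1))
  have hk : W.k a j = W.k b i := by
    rcases lt_trichotomy (W.k a j) (W.k b i) with hlt | heq | hlt
    · have := h (W.k a j)
      rw [hx, W.letter_x hlt] at this
      simp at this
    · exact heq
    · have := h (W.k b i)
      rw [hx, W.letter_x hlt] at this
      simp at this
  refine ⟨hk, ?_⟩
  rcases lt_trichotomy (W.l a j) (W.l b i) with hlt | heq | hlt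
  · have := h (W.k a j + W.l a j)
    rw [hy, hk, ← add_assoc, ← yStart_eq, W.letter_y hlt] at this
    simp at this
  · exact heq
  · have := h (W.k b i + W.l b i)
    rw [hy, ← hk, ← add_assoc, ← yStart_eq, W.letter_y hlt] at this
    simp at this

theorem agree_of_letter {a b : Fin c} {j i : ℕ}
    (h : ∀ N, W.letter a (W.xStart a j + N) = W.letter b (W.xStart b i + N)) :
    W.Agree a j b i := by
  intro q
  induction q generalizing j i with
  | zero => exact W.exponents_eq_of_letter h
  | succ q ih =>
    have h0 := W.exponents_eq_of_letter h
    have := @ih (j + 1) (i + 1) fun N => by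
      have := h (W.k a j + W.l a j + N)
      rw [xStart_succ, xStart_succ, yStart_eq, yStart_eq]
      rw [← add_assoc, ← add_assoc, h0.1, h0.2, ← add_assoc, ← add_assoc] at this
      rw [h0.1, h0.2]
      exact this
    rwa [add_right_comm, add_right_comm i] at this

/-- Positions with the same itinerary come with indices at which the exponents agree. -/
theorem exists_agree {a b : Fin c} {N N' : ℕ}
    (h : ∀ n, W.letter a (N + n) = W.letter b (N' + n)) : ∃ j i, W.Agree a j b i := by
  -- the start of a power of `x` after `N` is a place where `x` follows `y`
  have hN : N < W.xStart a (N + 1) :=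
    lt_of_lt_of_le N.lt_succ_self ((W.strictMono_xStart a).id_le _)
  obtain ⟨n, hn⟩ := Nat.exists_eq_add_of_lt hN
  have hl : W.letter a (N + n) = false := by
    have := W.l_pos a N
    have e : N + n = W.yStart a N + (W.l a N - 1) := by
      rw [xStart_succ] at hn
      omega
    rw [e, W.letter_y (by omega)]
  have ht : W.letter a (N + (n + 1)) = true := by
    rw [← add_assoc, ← hn]
    simpa using W.letter_x (r := 0) (W.k_pos a (N + 1))
  rw [h] at hl ht
  rw [← add_assoc] at ht
  have hi : ∃ i, N' + n + 1 = W.xStart b i := by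
    obtain ⟨i, h1, h2⟩ := W.exists_block b (N' + n + 1)
    obtain ⟨r, hr⟩ := Nat.exists_eq_add_of_le h1
    rcases Nat.eq_zero_or_pos r with h0 | h0
    · exact ⟨i, by omega⟩
    · rw [xStart_succ, yStart_eq] at h2
      rcases lt_or_ge r (W.k b i) with hlt | hge
      · rw [show N' + n = W.xStart b i + (r - 1) by omega, W.letter_x (by omega)] at hl
        simp at hl
      · rw [show N' + n + 1 = W.yStart b i + (r - W.k b i) by rw [yStart_eq]; omega,
          W.letter_y (by omega)] at ht
        simp at ht
  obtain ⟨i, hi⟩ := hi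
  refine ⟨N + 1, i, W.agree_of_letter fun q => ?_⟩
  rw [hn, ← hi]
  have := h (n + 1 + q)
  rwa [← add_assoc, ← add_assoc, ← add_assoc, ← add_assoc] at this

theorem agree_of_relabel {a b : Fin c} {d : ℕ}
    (h : ∀ j, W.k b (j + d) = W.k a j ∧ W.l b (j + d) = W.l a j) (j : ℕ) :
    W.Agree b (j + d) a j := fun q => by
  rw [add_right_comm]
  exact h (j + q)

theorem xStart_add_of_relabel {a b : Fin c} {d : ℕ}
    (h : ∀ j, W.k b (j + d) = W.k a j ∧ W.l b (j + d) = W.l a j) (j : ℕ) :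
    W.xStart b (j + d) = W.xStart a j + W.xStart b d := by
  have h0 := W.agree_of_relabel h 0
  rw [zero_add] at h0
  have := h0.xStart_add j
  rw [xStart_zero, add_zero, zero_add] at this
  rw [add_comm j d, this]

theorem letter_add_of_relabel {a b : Fin c} {d : ℕ}
    (h : ∀ j, W.k b (j + d) = W.k a j ∧ W.l b (j + d) = W.l a j) (N : ℕ) :
    W.letter b (N + W.xStart b d) = W.letter a N := by
  have h0 := W.agree_of_relabel h 0
  rw [zero_add] at h0
  have := h0.letter N
  rwa [xStart_zero, zero_add, add_comm] at this

theorem relabel_period (a : Fin c) (j : ℕ) :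
    W.k a (j + W.n a) = W.k a j ∧ W.l a (j + W.n a) = W.l a j :=
  ⟨W.k_periodic a j, W.l_periodic a j⟩

theorem xStart_add_n (a : Fin c) (j : ℕ) : W.xStart a (j + W.n a) = W.xStart a j + W.length a :=
  W.xStart_add_of_relabel (W.relabel_period a) j

theorem letter_periodic (a : Fin c) : Function.Periodic (W.letter a) (W.length a) :=
  W.letter_add_of_relabel (W.relabel_period a)

theorem length_pos (a : Fin c) : 0 < W.length a :=
  (W.strictMono_xStart a) (W.n_pos a)

theorem xStart_add_mul (a : Fin c) (j q : ℕ) :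
    W.xStart a (j + q * W.n a) = W.xStart a j + q * W.length a := by
  induction q with
  | zero => simp
  | succ q ih => rw [add_mul, one_mul, ← add_assoc, xStart_add_n, ih, add_mul, one_mul, add_assoc]

theorem length_eq_of_relabel {a b : Fin c} {d : ℕ} (hn : W.n b = W.n a)
    (h : ∀ j, W.k b (j + d) = W.k a j ∧ W.l b (j + d) = W.l a j) : W.length b = W.length a := by
  have h1 := W.xStart_add_of_relabel h (W.n a)
  have h2 := W.xStart_add_n b d
  rw [hn, add_comm d, h1] at h2
  rw [length] at h2 ⊢
  rw [length]
  omega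

/-- The word periods are the least ones: equal sequences of exponents of one component start at
indices that are congruent modulo the word period. In other words, no word is a proper power. -/
def Primitive : Prop := ∀ a j i, W.Agree a j a i → j ≡ i [MOD W.n a]

variable {W}

theorem Primitive.n_eq (hW : W.Primitive) {a b : Fin c} {j i : ℕ} (h : W.Agree a j b i) :
    W.n a = W.n b := by
  have key : ∀ {a b : Fin c} {j i : ℕ}, W.Agree a j b i → W.n b ∣ W.n a := by
    intro a b j i h
    have h1 := W.agree_add_mul a j 1
    rw [one_mul] at h1
    have h2 := hW b _ _ ((h.add (W.n a)).symm.trans (h1.trans h))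
    exact (Nat.modEq_zero_iff_dvd.1 (Nat.ModEq.add_left_cancel' i h2))
  exact Nat.dvd_antisymm (key h.symm) (key h)

/-- Words with the same itinerary somewhere are equal up to a shift. -/
theorem Primitive.exists_relabel (hW : W.Primitive) {a b : Fin c} {j i : ℕ}
    (h : W.Agree a j b i) :
    ∃ d, W.n b = W.n a ∧ ∀ q, W.k b (q + d) = W.k a q ∧ W.l b (q + d) = W.l a q := by
  obtain ⟨e, he⟩ : ∃ e, j * W.n a = j + e :=
    Nat.exists_eq_add_of_le (Nat.le_mul_of_pos_right j (W.n_pos a))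
  refine ⟨i + e, (hW.n_eq h).symm, fun q => ?_⟩
  have h1 := h (e + q)
  have h2 : q + j * W.n a = j + (e + q) := by omega
  rw [show q + (i + e) = i + (e + q) by ring, ← h1.1, ← h1.2, ← h2]
  exact ⟨W.k_add_mul a q j, W.l_add_mul a q j⟩

variable (W)

/-! ### The orders within the full bunches -/

theorem xTail_two_mul (a : Fin c) (j q : ℕ) : W.xTail a j (2 * q) = W.l a (j + q) := by
  rw [xTail, if_pos (even_two_mul q), Nat.mul_div_cancel_left q two_pos]

theorem xTail_two_mul_add_one (a : Fin c) (j q : ℕ) :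
    W.xTail a j (2 * q + 1) = -(W.k a (j + q + 1) : ℤ) := by
  rw [xTail, if_neg (by simp), show (2 * q + 1) / 2 = q by omega]

theorem yTail_two_mul (a : Fin c) (j q : ℕ) : W.yTail a j (2 * q) = -(W.k a (j + q + 1) : ℤ) := by
  rw [yTail, if_pos (even_two_mul q), Nat.mul_div_cancel_left q two_pos]

theorem yTail_two_mul_add_one (a : Fin c) (j q : ℕ) :
    W.yTail a j (2 * q + 1) = W.l a (j + q + 1) := by
  rw [yTail, if_neg (by simp), show (2 * q + 1) / 2 = q by omega]

/-- The tail of exponents is its first entry followed by the tail of the other kind. -/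
theorem xTail_succ (a : Fin c) (j m : ℕ) : W.xTail a j (m + 1) = W.yTail a j m := by
  obtain ⟨q, rfl | rfl⟩ := Nat.even_or_odd' m
  · rw [xTail_two_mul_add_one, yTail_two_mul]
  · rw [show 2 * q + 1 + 1 = 2 * (q + 1) by ring, xTail_two_mul, yTail_two_mul_add_one, add_assoc]

theorem yTail_succ (a : Fin c) (j m : ℕ) : W.yTail a j (m + 1) = W.xTail a (j + 1) m := by
  obtain ⟨q, rfl | rfl⟩ := Nat.even_or_odd' m
  · rw [xTail_two_mul, yTail_two_mul_add_one, add_right_comm]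
  · rw [show 2 * q + 1 + 1 = 2 * (q + 1) by ring, yTail_two_mul, xTail_two_mul_add_one]
    congr 3
    ring

theorem xTail_zero (a : Fin c) (j : ℕ) : W.xTail a j 0 = W.l a j := W.xTail_two_mul a j 0

theorem yTail_zero (a : Fin c) (j : ℕ) : W.yTail a j 0 = -(W.k a (j + 1) : ℤ) :=
  W.yTail_two_mul a j 0

theorem yTail_eq_iff {a b : Fin c} {j i : ℕ} : W.yTail a j = W.yTail b i ↔ W.Agree a j b i := by
  refine ⟨fun h => Agree.of_add (r := 1) fun q => ?_, fun h => funext fun m => ?_⟩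
  · have h1 := congrFun h (2 * q)
    have h2 := congrFun h (2 * q + 1)
    rw [yTail_two_mul, yTail_two_mul] at h1
    rw [yTail_two_mul_add_one, yTail_two_mul_add_one] at h2
    rw [add_right_comm, add_right_comm i]
    omega
  · obtain ⟨q, rfl | rfl⟩ := Nat.even_or_odd' m
    · rw [yTail_two_mul, yTail_two_mul, add_assoc, add_assoc, (h (q + 1)).1]
    · rw [yTail_two_mul_add_one, yTail_two_mul_add_one, add_assoc, add_assoc, (h (q + 1)).2]

theorem xTail_eq_iff {a b : Fin c} {j i : ℕ} : W.xTail a j = W.xTail b i ↔ W.Agree a j b i := by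
  refine ⟨fun h => W.yTail_eq_iff.1 (funext fun m => ?_), fun h => funext fun m => ?_⟩
  · rw [← xTail_succ, ← xTail_succ, h]
  · cases m with
    | zero => rw [xTail_zero, xTail_zero]; exact_mod_cast (h 0).2
    | succ m => rw [xTail_succ, xTail_succ, W.yTail_eq_iff.2 h]

/-- The key by which the full `x`-bunch is sorted. -/
def xKey (a : Fin c) (j : ℕ) : Lex (ℕ → ℤ) ×ₗ Fin c := toLex (toLex (W.xTail a j), a)

/-- The key by which the full `y`-bunch is sorted. -/
def yKey (a : Fin c) (j : ℕ) : Lex (ℕ → ℤ) ×ₗ Fin c := toLex (toLex (W.yTail a j), a)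

theorem xBefore_iff {a b : Fin c} {j i : ℕ} : W.XBefore a j b i ↔ W.xKey a j < W.xKey b i := by
  rw [xKey, xKey, Prod.Lex.toLex_lt_toLex]
  rfl

theorem yBefore_iff {a b : Fin c} {j i : ℕ} : W.YBefore a j b i ↔ W.yKey a j < W.yKey b i := by
  rw [yKey, yKey, Prod.Lex.toLex_lt_toLex]
  rfl

theorem xKey_eq_iff {a b : Fin c} {j i : ℕ} :
    W.xKey a j = W.xKey b i ↔ a = b ∧ W.Agree a j b i := by
  rw [xKey, xKey, toLex_inj, Prod.mk.injEq, toLex_inj, xTail_eq_iff, and_comm]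

theorem yKey_eq_iff {a b : Fin c} {j i : ℕ} :
    W.yKey a j = W.yKey b i ↔ a = b ∧ W.Agree a j b i := by
  rw [yKey, yKey, toLex_inj, Prod.mk.injEq, toLex_inj, yTail_eq_iff, and_comm]

/-- An equal first entry can be deleted from a lexicographic comparison. -/
theorem lexLT_of_lexLT_succ {e f e' f' : ℕ → ℤ} (h0 : e 0 = f 0)
    (he : ∀ m, e (m + 1) = e' m) (hf : ∀ m, f (m + 1) = f' m) (h : LexLT e f) : LexLT e' f' := by
  obtain ⟨m, h1, h2⟩ := h
  cases m with
  | zero => exact absurd h0 h2.ne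
  | succ m =>
    refine ⟨m, fun q hq => ?_, ?_⟩
    · rw [← he, ← hf, h1 _ (by omega)]
    · rwa [← he, ← hf]

theorem le_of_lexLT {e f : ℕ → ℤ} (h : LexLT e f) : e 0 ≤ f 0 := by
  obtain ⟨m, h1, h2⟩ := h
  cases m with
  | zero => exact h2.le
  | succ m => exact (h1 0 m.succ_pos).le

theorem l_le_of_xBefore {a b : Fin c} {j i : ℕ} (h : W.XBefore a j b i) : W.l a j ≤ W.l b i := by
  rcases h with h | ⟨h, -⟩
  · have := le_of_lexLT h
    rw [xTail_zero, xTail_zero] at this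
    exact_mod_cast this
  · exact ((W.xTail_eq_iff.1 h) 0).2.le

theorem k_le_of_yBefore {a b : Fin c} {j i : ℕ} (h : W.YBefore a j b i) :
    W.k b (i + 1) ≤ W.k a (j + 1) := by
  rcases h with h | ⟨h, -⟩
  · have := le_of_lexLT h
    rw [yTail_zero, yTail_zero] at this
    omega
  · exact ((W.yTail_eq_iff.1 h) 1).1.ge

/-- The order within the full `x`-bunch passes to the order within the full `y`-bunch if the
first exponents that follow coincide. -/
theorem yBefore_of_xBefore {a b : Fin c} {j i : ℕ} (h : W.XBefore a j b i)
    (hl : W.l a j = W.l b i) : W.YBefore a j b i := by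
  rcases h with h | ⟨h, hab⟩
  · refine Or.inl (lexLT_of_lexLT_succ ?_ (W.xTail_succ a j) (W.xTail_succ b i) h)
    rw [xTail_zero, xTail_zero, hl]
  · exact Or.inr ⟨W.yTail_eq_iff.2 (W.xTail_eq_iff.1 h), hab⟩

theorem xBefore_of_yBefore {a b : Fin c} {j i : ℕ} (h : W.YBefore a j b i)
    (hk : W.k a (j + 1) = W.k b (i + 1)) : W.XBefore a (j + 1) b (i + 1) := by
  rcases h with h | ⟨h, hab⟩
  · refine Or.inl (lexLT_of_lexLT_succ ?_ (W.yTail_succ a j) (W.yTail_succ b i) h)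
    rw [yTail_zero, yTail_zero, hk]
  · exact Or.inr ⟨W.xTail_eq_iff.2 ((W.yTail_eq_iff.1 h).add 1), hab⟩

theorem card_base : Nat.card W.Base = W.trip := by
  simp [trip, Nat.card_eq_fintype_card]

/-- Counting the smaller elements of a finite family preserves the order of its members. -/
theorem ncard_lt_iff {ι α : Type*} [Finite ι] [LinearOrder α] {f : ι → α} {x y : α}
    (hx : x ∈ range f) (hy : y ∈ range f) :
    {i | f i < x}.ncard < {i | f i < y}.ncard ↔ x < y := by
  have key : ∀ {x y : α}, x ∈ range f → x < y → {i | f i < x}.ncard < {i | f i < y}.ncard := by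
    rintro x y ⟨i, rfl⟩ hxy
    refine Set.ncard_lt_ncard ⟨fun q hq => lt_trans hq hxy, fun hsub => ?_⟩ (Set.toFinite _)
    exact lt_irrefl (f i) (hsub (show f i < y from hxy))
  refine ⟨fun h => ?_, key hx⟩
  by_contra! hle
  rcases hle.eq_or_lt with rfl | hlt
  · exact lt_irrefl _ h
  · exact (key hy hlt).asymm h

theorem xKey_mem_range (a : Fin c) (j : ℕ) :
    W.xKey a j ∈ range fun i : W.Base => W.xKey i.1 i.2 :=
  ⟨⟨a, ⟨j % W.n a, Nat.mod_lt _ (W.n_pos a)⟩⟩, W.xKey_eq_iff.2 ⟨rfl, (W.agree_mod a j).symm⟩⟩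

theorem yKey_mem_range (a : Fin c) (j : ℕ) :
    W.yKey a j ∈ range fun i : W.Base => W.yKey i.1 i.2 :=
  ⟨⟨a, ⟨j % W.n a, Nat.mod_lt _ (W.n_pos a)⟩⟩, W.yKey_eq_iff.2 ⟨rfl, (W.agree_mod a j).symm⟩⟩

theorem xRank_lt_iff {a b : Fin c} {j i : ℕ} :
    W.xRank a j < W.xRank b i ↔ W.XBefore a j b i := by
  simp only [xRank, xBefore_iff]
  exact ncard_lt_iff (W.xKey_mem_range a j) (W.xKey_mem_range b i)

theorem yRank_lt_iff {a b : Fin c} {j i : ℕ} :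
    W.yRank a j < W.yRank b i ↔ W.YBefore a j b i := by
  simp only [yRank, yBefore_iff]
  exact ncard_lt_iff (W.yKey_mem_range a j) (W.yKey_mem_range b i)

theorem xRank_eq_iff {a b : Fin c} {j i : ℕ} :
    W.xRank a j = W.xRank b i ↔ a = b ∧ W.Agree a j b i := by
  rw [← xKey_eq_iff]
  have h1 := W.xRank_lt_iff (a := a) (b := b) (j := j) (i := i)
  have h2 := W.xRank_lt_iff (a := b) (b := a) (j := i) (i := j)
  rw [xBefore_iff] at h1 h2
  rcases lt_trichotomy (W.xKey a j) (W.xKey b i) with h | h | h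
  · exact iff_of_false (h1.2 h).ne h.ne
  · refine iff_of_true ?_ h
    rw [h, lt_self_iff_false, iff_false, not_lt] at h1 h2
    exact le_antisymm h2 h1
  · exact iff_of_false (h2.2 h).ne' h.ne'

theorem yRank_eq_iff {a b : Fin c} {j i : ℕ} :
    W.yRank a j = W.yRank b i ↔ a = b ∧ W.Agree a j b i := by
  rw [← yKey_eq_iff]
  have h1 := W.yRank_lt_iff (a := a) (b := b) (j := j) (i := i)
  have h2 := W.yRank_lt_iff (a := b) (b := a) (j := i) (i := j)
  rw [yBefore_iff] at h1 h2
  rcases lt_trichotomy (W.yKey a j) (W.yKey b i) with h | h | h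
  · exact iff_of_false (h1.2 h).ne h.ne
  · refine iff_of_true ?_ h
    rw [h, lt_self_iff_false, iff_false, not_lt] at h1 h2
    exact le_antisymm h2 h1
  · exact iff_of_false (h2.2 h).ne' h.ne'

theorem xRank_lt_trip (a : Fin c) (j : ℕ) : W.xRank a j < W.trip := by
  rw [← card_base, ← Set.ncard_univ]
  obtain ⟨i, hi⟩ := W.xKey_mem_range a j
  refine Set.ncard_lt_ncard ⟨Set.subset_univ _, fun h => ?_⟩ (Set.toFinite _)
  have : W.XBefore i.1 i.2 a j := h (mem_univ i)
  rw [xBefore_iff, ← hi] at this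
  exact lt_irrefl _ this

theorem yRank_lt_trip (a : Fin c) (j : ℕ) : W.yRank a j < W.trip := by
  rw [← card_base, ← Set.ncard_univ]
  obtain ⟨i, hi⟩ := W.yKey_mem_range a j
  refine Set.ncard_lt_ncard ⟨Set.subset_univ _, fun h => ?_⟩ (Set.toFinite _)
  have : W.YBefore i.1 i.2 a j := h (mem_univ i)
  rw [yBefore_iff, ← hi] at this
  exact lt_irrefl _ this

end CodeWords

namespace CodeWords

variable {c : ℕ} (W : CodeWords c)

/-! ### The points drawn on the branch line -/

theorem mark_neg (k : ℕ) : mark (-k) = (1 / 2) ^ (k + 1) := by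
  rw [mark, if_pos (by omega), Int.natAbs_neg, Int.natAbs_natCast]

theorem mark_neg_add_one {k : ℕ} (hk : 1 ≤ k) : mark (-k + 1) = (1 / 2) ^ k := by
  obtain ⟨r, rfl⟩ := Nat.exists_eq_add_of_le' hk
  have : -((r + 1 : ℕ) : ℤ) + 1 = -(r : ℤ) := by push_cast; ring
  rw [this, mark_neg]

theorem mark_pos {l : ℕ} (hl : 1 ≤ l) : mark l = 1 - (1 / 2) ^ (l + 1) := by
  rw [mark, if_neg (by omega), Int.natAbs_natCast]

theorem mark_pos_sub_one {l : ℕ} (hl : 1 ≤ l) : mark (l - 1) = 1 - (1 / 2) ^ l := by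
  obtain ⟨r, rfl⟩ := Nat.exists_eq_add_of_le' hl
  have : ((r + 1 : ℕ) : ℤ) - 1 = r := by push_cast; ring
  rw [this]
  rcases Nat.eq_zero_or_pos r with rfl | h
  · have := mark_neg 0
    norm_num at this ⊢
    exact this
  · rw [mark_pos h]

/-- The relative position of a label with `r` predecessors within an interval. -/
noncomputable def offset (r : ℕ) : ℝ := (r + 1) / (W.trip + 1)

theorem offset_pos (r : ℕ) : 0 < W.offset r := by unfold offset; positivity

theorem offset_lt_one {r : ℕ} (h : r < W.trip) : W.offset r < 1 := by
  have : (r : ℝ) < W.trip := by exact_mod_cast h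
  rw [offset, div_lt_one (by positivity)]
  linarith

theorem offset_lt_iff {r s : ℕ} : W.offset r < W.offset s ↔ r < s := by
  rw [offset, offset, div_lt_div_iff_of_pos_right (by positivity)]
  simp

theorem xPoint_eq {k : ℕ} (hk : 1 ≤ k) (a : Fin c) (j : ℕ) :
    W.xPoint k a j = (1 / 2) ^ (k + 1) * (1 + W.offset (W.xRank a j)) := by
  rw [xPoint, mark_neg, mark_neg_add_one hk, offset]
  ring

theorem yPoint_eq {l : ℕ} (hl : 1 ≤ l) (a : Fin c) (j : ℕ) :
    W.yPoint l a j = 1 - (1 / 2) ^ (l + 1) * (2 - W.offset (W.yRank a j)) := by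
  rw [yPoint, mark_pos hl, mark_pos_sub_one hl, offset]
  ring

theorem xPoint_bounds {k : ℕ} (hk : 1 ≤ k) (a : Fin c) (j : ℕ) :
    (1 / 2) ^ (k + 1) < W.xPoint k a j ∧ W.xPoint k a j < (1 / 2) ^ k := by
  have h1 := W.offset_pos (W.xRank a j)
  have h2 := W.offset_lt_one (W.xRank_lt_trip a j)
  have h3 : (0 : ℝ) < (1 / 2) ^ k := by positivity
  rw [W.xPoint_eq hk, pow_succ]
  constructor <;> nlinarith

theorem yPoint_bounds {l : ℕ} (hl : 1 ≤ l) (a : Fin c) (j : ℕ) :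
    1 - (1 / 2) ^ l < W.yPoint l a j ∧ W.yPoint l a j < 1 - (1 / 2) ^ (l + 1) := by
  have h1 := W.offset_pos (W.yRank a j)
  have h2 := W.offset_lt_one (W.yRank_lt_trip a j)
  have h3 : (0 : ℝ) < (1 / 2) ^ l := by positivity
  rw [W.yPoint_eq hl, pow_succ]
  constructor <;> nlinarith

theorem half_pow_le_half {k : ℕ} (hk : 1 ≤ k) : (1 / 2 : ℝ) ^ k ≤ 1 / 2 := by
  simpa using pow_le_pow_of_le_one (by norm_num : (0 : ℝ) ≤ 1 / 2) (by norm_num) hk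

theorem xPoint_mem {k : ℕ} (hk : 1 ≤ k) (a : Fin c) (j : ℕ) :
    W.xPoint k a j ∈ Ioo (0 : ℝ) (1 / 2) := by
  have h := W.xPoint_bounds hk a j
  exact ⟨lt_trans (by positivity) h.1, h.2.trans_le (half_pow_le_half hk)⟩

theorem yPoint_mem {l : ℕ} (hl : 1 ≤ l) (a : Fin c) (j : ℕ) :
    W.yPoint l a j ∈ Ioo (1 / 2 : ℝ) 1 := by
  have h := W.yPoint_bounds hl a j
  have h3 : (0 : ℝ) < (1 / 2) ^ (l + 1) := by positivity
  have := half_pow_le_half hl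
  exact ⟨by linarith, by linarith⟩

theorem xPoint_lt_of_lt {k k' : ℕ} (hk' : 1 ≤ k') (h : k' < k) (a b : Fin c) (j i : ℕ) :
    W.xPoint k a j < W.xPoint k' b i := by
  refine (W.xPoint_bounds (hk'.trans h.le) a j).2.trans_le
    (le_trans ?_ (W.xPoint_bounds hk' b i).1.le)
  exact pow_le_pow_of_le_one (by norm_num) (by norm_num) h

theorem yPoint_lt_of_lt {l l' : ℕ} (hl : 1 ≤ l) (h : l < l') (a b : Fin c) (j i : ℕ) :
    W.yPoint l a j < W.yPoint l' b i := by
  refine (W.yPoint_bounds hl a j).2.trans_le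
    (le_trans ?_ (W.yPoint_bounds (hl.trans h.le) b i).1.le)
  exact sub_le_sub_left (pow_le_pow_of_le_one (by norm_num) (by norm_num) h) 1

theorem xPoint_lt_iff {k : ℕ} (hk : 1 ≤ k) {a b : Fin c} {j i : ℕ} :
    W.xPoint k a j < W.xPoint k b i ↔ W.XBefore a j b i := by
  rw [W.xPoint_eq hk, W.xPoint_eq hk, mul_lt_mul_iff_right₀ (by positivity), add_lt_add_iff_left,
    offset_lt_iff, xRank_lt_iff]

theorem yPoint_lt_iff {l : ℕ} (hl : 1 ≤ l) {a b : Fin c} {j i : ℕ} :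
    W.yPoint l a j < W.yPoint l b i ↔ W.YBefore a j b i := by
  rw [W.yPoint_eq hl, W.yPoint_eq hl, sub_lt_sub_iff_left, mul_lt_mul_iff_right₀ (by positivity),
    sub_lt_sub_iff_left, offset_lt_iff, yRank_lt_iff]

/-- The point of the branch line where the algorithm starts the turn number `N` of the
component `a`. -/
noncomputable def point (a : Fin c) (N : ℕ) : ℝ :=
  if W.letter a N then W.xPoint (W.yStart a (W.block a N) - N) a (W.block a N)
  else W.yPoint (W.xStart a (W.block a N + 1) - N) a (W.block a N)

theorem point_x {a : Fin c} {j k : ℕ} (hk : 1 ≤ k) (hk' : k ≤ W.k a j) :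
    W.point a (W.xStart a j + (W.k a j - k)) = W.xPoint k a j := by
  rw [point, W.letter_x (by omega), W.block_x (by omega), if_pos rfl, yStart_eq]
  congr 1
  omega

theorem point_y {a : Fin c} {j l : ℕ} (hl : 1 ≤ l) (hl' : l ≤ W.l a j) :
    W.point a (W.yStart a j + (W.l a j - l)) = W.yPoint l a j := by
  rw [point, W.letter_y (by omega), W.block_y (by omega), if_neg (by simp), xStart_succ]
  congr 1
  omega

theorem point_x_succ {a : Fin c} {j k : ℕ} (hk : 2 ≤ k) (hk' : k ≤ W.k a j) :
    W.point a (W.xStart a j + (W.k a j - k) + 1) = W.xPoint (k - 1) a j := by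
  rw [← W.point_x (by omega : 1 ≤ k - 1) (by omega)]
  congr 1
  omega

theorem point_x_last (a : Fin c) (j : ℕ) :
    W.point a (W.xStart a j + (W.k a j - 1) + 1) = W.yPoint (W.l a j) a j := by
  have := W.k_pos a j
  rw [← W.point_y (W.l_pos a j) le_rfl, yStart_eq]
  congr 1
  omega

theorem point_y_succ {a : Fin c} {j l : ℕ} (hl : 2 ≤ l) (hl' : l ≤ W.l a j) :
    W.point a (W.yStart a j + (W.l a j - l) + 1) = W.yPoint (l - 1) a j := by
  rw [← W.point_y (by omega : 1 ≤ l - 1) (by omega)]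
  congr 1
  omega

theorem point_y_last (a : Fin c) (j : ℕ) :
    W.point a (W.yStart a j + (W.l a j - 1) + 1) = W.xPoint (W.k a (j + 1)) a (j + 1) := by
  have := W.l_pos a j
  rw [← W.point_x (W.k_pos a (j + 1)) le_rfl, xStart_succ]
  congr 1
  omega

theorem exists_index_x {a : Fin c} {N : ℕ} (h : W.letter a N = true) :
    ∃ j q, 1 ≤ q ∧ q ≤ W.k a j ∧ N = W.xStart a j + (W.k a j - q) := by
  rcases W.exists_index a N with h' | ⟨j, q, h1, h2, rfl⟩
  · exact h'
  · rw [W.letter_y (by omega)] at h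
    simp at h

theorem exists_index_y {a : Fin c} {N : ℕ} (h : W.letter a N = false) :
    ∃ j q, 1 ≤ q ∧ q ≤ W.l a j ∧ N = W.yStart a j + (W.l a j - q) := by
  rcases W.exists_index a N with ⟨j, q, h1, h2, rfl⟩ | h'
  · rw [W.letter_x (by omega)] at h
    simp at h
  · exact h'

theorem point_mem (a : Fin c) (N : ℕ) :
    W.point a N ∈ if W.letter a N then Ioo (0 : ℝ) (1 / 2) else Ioo (1 / 2 : ℝ) 1 := by
  cases h : W.letter a N
  · obtain ⟨j, q, h1, h2, rfl⟩ := W.exists_index_y h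
    rw [W.point_y h1 h2]
    exact W.yPoint_mem h1 a j
  · obtain ⟨j, q, h1, h2, rfl⟩ := W.exists_index_x h
    rw [W.point_x h1 h2]
    exact W.xPoint_mem h1 a j

theorem point_mem_Icc (a : Fin c) (N : ℕ) : W.point a N ∈ Icc (0 : ℝ) 1 := by
  have h := W.point_mem a N
  split_ifs at h <;> constructor <;> linarith [h.1, h.2]

/-- The semiflow of either strip is monotone on the points drawn. -/
theorem point_succ_lt {a b : Fin c} {N N' : ℕ} (hw : W.letter a N = W.letter b N')
    (h : W.point a N < W.point b N') : W.point a (N + 1) < W.point b (N' + 1) := by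
  cases ha : W.letter a N
  · obtain ⟨j, q, h1, h2, rfl⟩ := W.exists_index_y ha
    obtain ⟨i, r, h3, h4, rfl⟩ := W.exists_index_y (hw ▸ ha)
    rw [W.point_y h1 h2, W.point_y h3 h4] at h
    have hle : q ≤ r := by
      by_contra! hlt
      exact h.asymm (W.yPoint_lt_of_lt h3 hlt b a i j)
    rcases hle.eq_or_lt with rfl | hlt
    · rw [W.yPoint_lt_iff h1] at h
      rcases h1.eq_or_lt with rfl | h1
      · rw [W.point_y_last, W.point_y_last]
        rcases (W.k_le_of_yBefore h).eq_or_lt with he | hlt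
        · rw [he, W.xPoint_lt_iff (W.k_pos _ _)]
          exact W.xBefore_of_yBefore h he.symm
        · exact W.xPoint_lt_of_lt (W.k_pos _ _) hlt _ _ _ _
      · rw [W.point_y_succ h1 h2, W.point_y_succ h1 h4, W.yPoint_lt_iff (by omega)]
        exact h
    · rw [W.point_y_succ (by omega) h4]
      rcases h1.eq_or_lt with rfl | h1
      · rw [W.point_y_last]
        exact (W.xPoint_mem (W.k_pos _ _) _ _).2.trans (W.yPoint_mem (by omega) _ _).1
      · rw [W.point_y_succ h1 h2]
        exact W.yPoint_lt_of_lt (by omega) (by omega) _ _ _ _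
  · obtain ⟨j, q, h1, h2, rfl⟩ := W.exists_index_x ha
    obtain ⟨i, r, h3, h4, rfl⟩ := W.exists_index_x (hw ▸ ha)
    rw [W.point_x h1 h2, W.point_x h3 h4] at h
    have hle : r ≤ q := by
      by_contra! hlt
      exact h.asymm (W.xPoint_lt_of_lt h1 hlt b a i j)
    rcases hle.eq_or_lt with rfl | hlt
    · rw [W.xPoint_lt_iff h1] at h
      rcases h1.eq_or_lt with rfl | h1
      · rw [W.point_x_last, W.point_x_last]
        rcases (W.l_le_of_xBefore h).eq_or_lt with he | hlt
        · rw [he, W.yPoint_lt_iff (W.l_pos _ _)]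
          exact W.yBefore_of_xBefore h he
        · exact W.yPoint_lt_of_lt (W.l_pos _ _) hlt _ _ _ _
      · rw [W.point_x_succ h1 h2, W.point_x_succ h1 h4, W.xPoint_lt_iff (by omega)]
        exact h
    · rw [W.point_x_succ (by omega) h2]
      rcases h3.eq_or_lt with rfl | h3
      · rw [W.point_x_last]
        exact (W.xPoint_mem (by omega) _ _).2.trans (W.yPoint_mem (W.l_pos _ _) _ _).1
      · rw [W.point_x_succ h3 h4]
        exact W.xPoint_lt_of_lt (by omega) (by omega) _ _ _ _

variable {W} in
/-- Different strands are drawn through different points. -/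
theorem Primitive.eq_of_point_eq (hW : W.Primitive) {a b : Fin c} {N N' : ℕ}
    (h : W.point a N = W.point b N') : a = b ∧ N ≡ N' [MOD W.length a] := by
  have mod_of : ∀ {a : Fin c} {j i : ℕ}, W.Agree a j a i →
      W.xStart a j ≡ W.xStart a i [MOD W.length a] := by
    intro a j i hji
    have hmod := hW a j i hji
    have hx : ∀ p, W.xStart a p ≡ W.xStart a (p % W.n a) [MOD W.length a] := fun p => by
      conv_lhs => rw [← Nat.mod_add_div p (W.n a), mul_comm, xStart_add_mul]
      simp [Nat.ModEq]
    exact (hx j).trans ((congrArg (W.xStart a) hmod ▸ (hx i).symm))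
  have hpa := W.point_mem a N
  have hpb := W.point_mem b N'
  cases ha : W.letter a N <;> cases hb : W.letter b N'
  · obtain ⟨j, q, h1, h2, rfl⟩ := W.exists_index_y ha
    obtain ⟨i, r, h3, h4, rfl⟩ := W.exists_index_y hb
    rw [W.point_y h1 h2, W.point_y h3 h4] at h
    have hqr : q = r := by
      rcases lt_trichotomy q r with hlt | heq | hlt
      · exact absurd h (W.yPoint_lt_of_lt h1 hlt _ _ _ _).ne
      · exact heq
      · exact absurd h (W.yPoint_lt_of_lt h3 hlt _ _ _ _).ne'
    subst hqr
    have hr : W.yRank a j = W.yRank b i := by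
      rcases lt_trichotomy (W.yRank a j) (W.yRank b i) with hlt | heq | hlt
      · exact absurd h ((W.yPoint_lt_iff h1).2 (W.yRank_lt_iff.1 hlt)).ne
      · exact heq
      · exact absurd h ((W.yPoint_lt_iff h1).2 (W.yRank_lt_iff.1 hlt)).ne'
    obtain ⟨rfl, hag⟩ := W.yRank_eq_iff.1 hr
    refine ⟨rfl, ?_⟩
    rw [yStart_eq, yStart_eq, ← (show W.k a j = W.k a i from (hag 0).1),
      ← (show W.l a j = W.l a i from (hag 0).2)]
    exact ((mod_of hag).add_right _).add_right _
  · rw [ha] at hpa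
    rw [hb] at hpb
    simp at hpa hpb
    linarith
  · rw [ha] at hpa
    rw [hb] at hpb
    simp at hpa hpb
    linarith
  · obtain ⟨j, q, h1, h2, rfl⟩ := W.exists_index_x ha
    obtain ⟨i, r, h3, h4, rfl⟩ := W.exists_index_x hb
    rw [W.point_x h1 h2, W.point_x h3 h4] at h
    have hqr : q = r := by
      rcases lt_trichotomy q r with hlt | heq | hlt
      · exact absurd h (W.xPoint_lt_of_lt h1 hlt _ _ _ _).ne'
      · exact heq
      · exact absurd h (W.xPoint_lt_of_lt h3 hlt _ _ _ _).ne
    subst hqr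
    have hr : W.xRank a j = W.xRank b i := by
      rcases lt_trichotomy (W.xRank a j) (W.xRank b i) with hlt | heq | hlt
      · exact absurd h ((W.xPoint_lt_iff h1).2 (W.xRank_lt_iff.1 hlt)).ne
      · exact heq
      · exact absurd h ((W.xPoint_lt_iff h1).2 (W.xRank_lt_iff.1 hlt)).ne'
    obtain ⟨rfl, hag⟩ := W.xRank_eq_iff.1 hr
    refine ⟨rfl, ?_⟩
    rw [← (show W.k a j = W.k a i from (hag 0).1)]
    exact (mod_of hag).add_right _

theorem point_periodic (a : Fin c) : Function.Periodic (W.point a) (W.length a) := by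
  intro N
  have hag : ∀ j, W.Agree a (j + W.n a) a j := W.agree_of_relabel (W.relabel_period a)
  cases h : W.letter a N
  · obtain ⟨j, q, h1, h2, rfl⟩ := W.exists_index_y h
    have e : W.yStart a j + (W.l a j - q) + W.length a =
        W.yStart a (j + W.n a) + (W.l a (j + W.n a) - q) := by
      rw [yStart_eq, yStart_eq, xStart_add_n, W.k_periodic, W.l_periodic]
      omega
    rw [e, W.point_y h1 h2, W.point_y h1 (by rwa [W.l_periodic]), W.yPoint_eq h1, W.yPoint_eq h1,
      W.yRank_eq_iff.2 ⟨rfl, hag j⟩]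
  · obtain ⟨j, q, h1, h2, rfl⟩ := W.exists_index_x h
    have e : W.xStart a j + (W.k a j - q) + W.length a =
        W.xStart a (j + W.n a) + (W.k a (j + W.n a) - q) := by
      rw [xStart_add_n, W.k_periodic]
      omega
    rw [e, W.point_x h1 h2, W.point_x h1 (by rwa [W.k_periodic]), W.xPoint_eq h1, W.xPoint_eq h1,
      W.xRank_eq_iff.2 ⟨rfl, hag j⟩]

/-! ### The turns drawn -/

/-- The coordinate across its strip of the turn number `N` of the component `a`, as drawn. -/
noncomputable def slide (a : Fin c) (N : ℕ) (t : ℝ) : ℝ :=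
  (1 - t) * (if W.letter a N then 2 * W.point a N else 2 * W.point a N - 1) + t * W.point a (N + 1)

/-- The turn number `N` of the component `a`, as drawn. -/
noncomputable def drawnTurn (u v : ℤ) (a : Fin c) (N : ℕ) (t : ℝ) : E3 :=
  page t (spot u v (W.letter a N) (W.slide a N t) t)

theorem slide_mem {a : Fin c} {N : ℕ} {t : ℝ} (ht : t ∈ Icc (0 : ℝ) 1) :
    W.slide a N t ∈ Icc (0 : ℝ) 1 := by
  have h1 := W.point_mem a N
  have h2 := W.point_mem_Icc a (N + 1)
  have h3 : (if W.letter a N then 2 * W.point a N else 2 * W.point a N - 1) ∈ Icc (0 : ℝ) 1 := by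
    split_ifs at h1 ⊢ <;> constructor <;> linarith [h1.1, h1.2]
  exact convex_Icc (0 : ℝ) 1 h3 h2 (sub_nonneg.2 ht.2) ht.1 (by ring)

theorem slide_lt {a b : Fin c} {N N' : ℕ} (hw : W.letter a N = W.letter b N')
    (h : W.point a N < W.point b N') {t : ℝ} (ht : t ∈ Icc (0 : ℝ) 1) :
    W.slide a N t < W.slide b N' t := by
  have h1 := W.point_succ_lt hw h
  have h2 : (if W.letter a N then 2 * W.point a N else 2 * W.point a N - 1) <
      (if W.letter b N' then 2 * W.point b N' else 2 * W.point b N' - 1) := by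
    rw [hw]
    split_ifs <;> linarith
  unfold slide
  rcases ht.1.eq_or_lt with h0 | h0
  · rw [← h0]
    linarith
  · have h3 := mul_lt_mul_of_pos_left h1 h0
    have h4 := mul_le_mul_of_nonneg_left h2.le (sub_nonneg.2 ht.2)
    linarith

theorem drawnTurn_zero (u v : ℤ) (a : Fin c) (N : ℕ) :
    W.drawnTurn u v a N 0 = page 0 (W.point a N : ℂ) := by
  rw [drawnTurn, spot_zero, slide]
  congr 2
  split_ifs <;> ring

theorem drawnTurn_one {u v : ℤ} (hu : Even u) (hv : Even v) (a : Fin c) (N : ℕ) :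
    W.drawnTurn u v a N 1 = page 0 (W.point a (N + 1) : ℂ) := by
  rw [drawnTurn, spot_one hu hv, slide]
  have := page_add_nat 0 1 (W.point a (N + 1) : ℂ)
  simpa using this

theorem continuous_drawnTurn (u v : ℤ) (a : Fin c) (N : ℕ) :
    Continuous (W.drawnTurn u v a N) := by
  have h1 : Continuous (W.slide a N) := by unfold slide; fun_prop
  exact continuous_page.comp (continuous_id.prodMk
    ((continuous_spot u v (W.letter a N)).comp (h1.prodMk continuous_id)))

theorem drawnTurn_periodic (u v : ℤ) (a : Fin c) (t : ℝ) :
    Function.Periodic (fun N => W.drawnTurn u v a N t) (W.length a) := fun N => by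
  have h := W.point_periodic a (N + 1)
  rw [add_right_comm] at h
  simp only [drawnTurn, slide, W.letter_periodic a N, W.point_periodic a N, h]

end CodeWords

/-! ### The link drawn by the bunch algorithm -/

theorem continuous_of_continuousOn_Icc_int {X : Type*} [TopologicalSpace X] {f : ℝ → X}
    (h : ∀ n : ℤ, ContinuousOn f (Icc n (n + 1))) : Continuous f := by
  rw [continuous_iff_continuousAt]
  intro x
  set n : ℤ := ⌊x + 1 / 2⌋ with hn
  have h1 := Int.floor_le (x + 1 / 2)
  have h2 := Int.lt_floor_add_one (x + 1 / 2)
  rw [← hn] at h1 h2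
  have h3 := (h (n - 1)).union_of_isClosed (h n) isClosed_Icc isClosed_Icc
  push_cast at h3
  rw [sub_add_cancel, Icc_union_Icc_eq_Icc (by linarith) (by linarith)] at h3
  exact h3.continuousAt (Icc_mem_nhds (by linarith) (by linarith))

namespace IsCodedLink

variable {u v : ℤ} {c : ℕ} {m : Fin c → ℕ} {word : Fin c → ℕ → Bool} {L : Fin c → ℝ → E3}

/-- A closed curve that runs through the strips according to a word stays in the template. -/
theorem mem_template_of_mem (hm : ∀ a, 0 < m a) (hp : ∀ a, Function.Periodic (L a) (m a))
    (hmem : ∀ a (N : ℕ), ∀ t ∈ Icc (0 : ℝ) 1, ∃ s ∈ Icc (0 : ℝ) 1,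
      L a (N + t) = page t (spot u v (word a N) s t)) (a : Fin c) (τ : ℝ) :
    L a τ ∈ template u v := by
  obtain ⟨N, t, ht, k, hk⟩ := exists_nat_add_eq (T := m a) (by exact_mod_cast hm a) τ
  have ht' : t ∈ Icc (0 : ℝ) 1 := ⟨ht.1, ht.2.le⟩
  obtain ⟨s, hs, he⟩ := hmem a N t ht'
  rw [← hk, (hp a).int_mul k] at he
  refine mem_biUnion ht' ?_
  rw [he]
  cases word a N
  · exact Or.inr ⟨s, hs, rfl⟩
  · exact Or.inl ⟨s, hs, rfl⟩

theorem turn_of_mem (hmem : ∀ a (N : ℕ), ∀ t ∈ Icc (0 : ℝ) 1, ∃ s ∈ Icc (0 : ℝ) 1,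
      L a (N + t) = page t (spot u v (word a N) s t)) (a : Fin c) (j : ℕ) :
    (∀ t ∈ Icc (0 : ℝ) 1, L a (j + t) ∈ leftLeaf u t) ∨
      (∀ t ∈ Icc (0 : ℝ) 1, L a (j + t) ∈ rightLeaf v t) := by
  cases hw : word a j
  · refine Or.inr fun t ht => ?_
    obtain ⟨s, hs, he⟩ := hmem a j t ht
    rw [hw] at he
    exact ⟨s, hs, he.symm⟩
  · refine Or.inl fun t ht => ?_
    obtain ⟨s, hs, he⟩ := hmem a j t ht
    rw [hw] at he
    exact ⟨s, hs, he.symm⟩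

theorem isCodeOf {W : CodeWords c} (h : IsCodedLink u v W.length W.letter L) :
    W.IsCodeOf u v L := by
  intro a j
  refine ⟨fun r hr t ht => ?_, fun r hr t ht => ?_⟩
  · obtain ⟨s, hs, he⟩ := h.mem a (W.xStart a j + r) t ht
    rw [W.letter_x hr] at he
    exact ⟨s, hs, he.symm⟩
  · obtain ⟨s, hs, he⟩ := h.mem a (W.yStart a j + r) t ht
    rw [W.letter_y hr] at he
    exact ⟨s, hs, he.symm⟩

theorem of_isCodeOf {W : CodeWords c} (hL : IsLorenzLikeLink u v W.length L)
    (hW : W.IsCodeOf u v L) : IsCodedLink u v W.length W.letter L where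
  link := hL
  word_periodic := W.letter_periodic
  mem a N t ht := by
    rcases W.exists_index a N with ⟨j, q, h1, h2, rfl⟩ | ⟨j, q, h1, h2, rfl⟩
    · rw [W.letter_x (by omega)]
      obtain ⟨s, hs, he⟩ := (hW a j).1 (W.k a j - q) (by omega) t ht
      exact ⟨s, hs, he.symm⟩
    · rw [W.letter_y (by omega)]
      obtain ⟨s, hs, he⟩ := (hW a j).2 (W.l a j - q) (by omega) t ht
      exact ⟨s, hs, he.symm⟩

/-- The words of an embedded link are primitive. -/
theorem primitive {W : CodeWords c} (hu : Even u) (hv : Even v)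
    (h : IsCodedLink u v W.length W.letter L) : W.Primitive := by
  intro a j i hag
  obtain ⟨q, hq⟩ := h.eq_of_itinerary hu hv hag.letter
  have key : ∀ (j i r : ℕ), W.xStart a i = W.xStart a j + r * W.length a →
      j ≡ i [MOD W.n a] := fun j i r hr => by
    rw [← W.xStart_add_mul] at hr
    rw [(W.strictMono_xStart a).injective hr]
    simp [Nat.ModEq]
  rcases le_total 0 q with h0 | h0
  · obtain ⟨r, rfl⟩ := Int.eq_ofNat_of_zero_le h0
    exact key j i r (by exact_mod_cast hq)
  · obtain ⟨r, hr⟩ := Int.eq_ofNat_of_zero_le (neg_nonneg.2 h0)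
    refine (key i j r ?_).symm
    zify
    rw [hq, ← hr]
    ring

/-- Components of a link renamed, and started at other powers of `x`, with the same words. -/
theorem relabel {W : CodeWords c} (h : IsCodedLink u v W.length W.letter L)
    {π : Fin c → Fin c} (hπ : Function.Injective π) {d : Fin c → ℕ}
    (hd : ∀ a, W.n (π a) = W.n a ∧
      ∀ j, W.k (π a) (j + d a) = W.k a j ∧ W.l (π a) (j + d a) = W.l a j) :
    IsCodedLink u v W.length W.letter (fun a τ => L (π a) (τ + W.xStart (π a) (d a))) := by
  have hlen : ∀ a, W.length (π a) = W.length a := fun a =>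
    W.length_eq_of_relabel (hd a).1 (hd a).2
  have hmem : ∀ a (N : ℕ), ∀ t ∈ Icc (0 : ℝ) 1, ∃ s ∈ Icc (0 : ℝ) 1,
      L (π a) (N + t + W.xStart (π a) (d a)) = page t (spot u v (W.letter a N) s t) := by
    intro a N t ht
    obtain ⟨s, hs, he⟩ := h.mem (π a) (N + W.xStart (π a) (d a)) t ht
    rw [W.letter_add_of_relabel (hd a).2] at he
    refine ⟨s, hs, he ▸ ?_⟩
    congr 1
    push_cast
    ring
  have hper : ∀ a, Function.Periodic (fun τ => L (π a) (τ + W.xStart (π a) (d a)))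
      (W.length a) := fun a τ => by
    have := h.link.periodic (π a) (τ + W.xStart (π a) (d a))
    rw [hlen] at this
    simp only [← this]
    congr 1
    ring
  refine ⟨⟨W.length_pos, fun a => ?_, hper, mem_template_of_mem W.length_pos hper hmem,
    turn_of_mem (L := fun a τ => L (π a) (τ + W.xStart (π a) (d a))) hmem,
    fun a b τ τ' he => ?_⟩, W.letter_periodic, hmem⟩
  · have := h.link.continuous (π a)
    fun_prop
  · obtain ⟨hab, q, hq⟩ := h.link.embedded _ _ _ _ he
    obtain rfl := hπ hab
    rw [hlen] at hq
    exact ⟨rfl, q, by linarith⟩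

theorem pos_relabel {W : CodeWords c} (π : Fin c → Fin c) (d : Fin c → ℕ) (a : Fin c) (N : ℕ) :
    pos (fun a τ => L (π a) (τ + W.xStart (π a) (d a))) a N =
      pos L (π a) (N + W.xStart (π a) (d a)) := by
  rw [pos, pos, coord, coord, Nat.cast_add, pageCoord_add_nat]

/-- The order of two strands with the same itinerary depends only on their components. -/
theorem pos_lt_iff_of_itinerary (hu : Even u) (hv : Even v) (h : IsCodedLink u v m word L)
    {a b : Fin c} {N N' A B : ℕ} (h1 : ∀ n, word a (N + n) = word b (N' + n))
    (h2 : ∀ n, word a (A + n) = word b (B + n)) :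
    pos L a N < pos L b N' ↔ pos L a A < pos L b B := by
  -- moving along the link, the first pair of strands is carried to the second
  obtain ⟨n, hn⟩ : ∃ n, N + n = A + N * m a := by
    obtain ⟨e, he⟩ := Nat.exists_eq_add_of_le (Nat.le_mul_of_pos_right N (h.link.period_pos a))
    exact ⟨A + e, by omega⟩
  have hA : ((N + n : ℕ) : ℤ) = A + (N : ℤ) * m a := by exact_mod_cast hn
  have hB : ∀ q, word b (B + q) = word b (N' + n + q) := fun q => by
    rw [← h2, add_assoc, ← h1, ← add_assoc, hn, add_right_comm, ← smul_eq_mul,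
      (h.word_periodic a).nsmul N]
  obtain ⟨q, hq⟩ := h.eq_of_itinerary hu hv hB
  rw [← h.pos_add_lt_iff hu hv n fun q _ => h1 q, h.pos_eq_of_eq hA, h.pos_eq_of_eq hq]

end IsCodedLink

namespace CodeWords

variable {c : ℕ} (W : CodeWords c)

/-- The four kinds of turns of a bunch drawing all join consecutive points `point a N`. -/
theorem isBunchDrawing_iff {u v : ℤ} {M : Fin c → ℝ → E3} :
    IsBunchDrawing u v W M ↔ (∀ a, Function.Periodic (M a) (W.length a)) ∧
      ∀ a (N : ℕ), ∀ t ∈ Icc (0 : ℝ) 1, M a (N + t) = W.drawnTurn u v a N t := by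
  have hx : ∀ a j k, 1 ≤ k → k ≤ W.k a j → ∀ t, W.drawnTurn u v a (W.xStart a j + (W.k a j - k)) t =
      leftTurn u (W.xPoint k a j) (W.point a (W.xStart a j + (W.k a j - k) + 1)) t := by
    intro a j k h1 h2 t
    rw [drawnTurn, slide, W.letter_x (by omega), W.point_x h1 h2]
    rfl
  have hy : ∀ a j l, 1 ≤ l → l ≤ W.l a j → ∀ t, W.drawnTurn u v a (W.yStart a j + (W.l a j - l)) t =
      rightTurn v (W.yPoint l a j) (W.point a (W.yStart a j + (W.l a j - l) + 1)) t := by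
    intro a j l h1 h2 t
    rw [drawnTurn, slide, W.letter_y (by omega), W.point_y h1 h2]
    rfl
  constructor
  · intro h
    refine ⟨h.periodic, fun a N t ht => ?_⟩
    rcases W.exists_index a N with ⟨j, q, h1, h2, rfl⟩ | ⟨j, q, h1, h2, rfl⟩
    · rw [hx a j q h1 h2]
      rcases h1.eq_or_lt with rfl | h1
      · rw [W.point_x_last, h.x_last a j t ht]
      · rw [W.point_x_succ h1 h2, h.x_turn a j q h1 h2 t ht]
    · rw [hy a j q h1 h2]
      rcases h1.eq_or_lt with rfl | h1
      · rw [W.point_y_last, h.y_last a j t ht]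
      · rw [W.point_y_succ h1 h2, h.y_turn a j q h1 h2 t ht]
  · rintro ⟨hp, h⟩
    refine ⟨hp, fun a j k h1 h2 t ht => ?_, fun a j t ht => ?_, fun a j l h1 h2 t ht => ?_,
      fun a j t ht => ?_⟩
    · rw [h _ _ t ht, hx a j k (by omega) h2, W.point_x_succ h1 h2]
    · rw [h _ _ t ht, hx a j 1 le_rfl (W.k_pos a j), W.point_x_last]
    · rw [h _ _ t ht, hy a j l (by omega) h2, W.point_y_succ h1 h2]
    · rw [h _ _ t ht, hy a j 1 le_rfl (W.l_pos a j), W.point_y_last]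

/-- The link drawn by the bunch algorithm. -/
noncomputable def drawnLink (u v : ℤ) (a : Fin c) (τ : ℝ) : E3 :=
  W.drawnTurn u v a (⌊τ⌋ % W.length a).toNat (Int.fract τ)

theorem isBunchDrawing_drawnLink {u v : ℤ} (hu : Even u) (hv : Even v) :
    IsBunchDrawing u v W (W.drawnLink u v) := by
  rw [isBunchDrawing_iff]
  have hnat : ∀ a (N : ℕ) t, W.drawnTurn u v a ((N : ℤ) % W.length a).toNat t =
      W.drawnTurn u v a N t := fun a N t => by
    have h1 : ((N : ℤ) % W.length a).toNat = N % W.length a := by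
      rw [← Int.natCast_mod, Int.toNat_natCast]
    rw [h1]
    exact (W.drawnTurn_periodic u v a t).map_mod_nat N
  refine ⟨fun a τ => ?_, fun a N t ht => ?_⟩
  · have h1 : ⌊τ + W.length a⌋ = ⌊τ⌋ + W.length a := Int.floor_add_natCast τ _
    rw [drawnLink, drawnLink, h1, Int.fract_add_natCast, Int.add_emod_right]
  · rw [drawnLink]
    rcases ht.2.eq_or_lt with rfl | h1
    · have h2 : (N : ℝ) + 1 = ((N + 1 : ℕ) : ℝ) := by push_cast; rfl
      rw [h2, Int.floor_natCast, Int.fract_natCast, hnat, drawnTurn_zero, W.drawnTurn_one hu hv]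
    · have h2 : ⌊(N : ℝ) + t⌋ = N := by
        rw [Int.floor_eq_iff]
        exact ⟨by simpa using ht.1, by simpa using h1⟩
      have h3 : Int.fract ((N : ℝ) + t) = t := by
        rw [Int.fract, h2]
        simp
      rw [h2, h3, hnat]

end CodeWords

section

open CodeWords

variable {c : ℕ} {W : CodeWords c}

theorem IsBunchDrawing.unique {u v : ℤ} {M M' : Fin c → ℝ → E3} (h : IsBunchDrawing u v W M)
    (h' : IsBunchDrawing u v W M') : M = M' := by
  rw [isBunchDrawing_iff] at h h'
  funext a τ
  obtain ⟨N, t, ht, k, hk⟩ := exists_nat_add_eq (T := W.length a)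
    (by exact_mod_cast W.length_pos a) τ
  have ht' : t ∈ Icc (0 : ℝ) 1 := ⟨ht.1, ht.2.le⟩
  rw [← (h.1 a).int_mul k, ← (h'.1 a).int_mul k, hk, h.2 a N t ht', h'.2 a N t ht']

/-- If no word is a proper power, the link drawn is embedded, with the given words. -/
theorem IsBunchDrawing.isCodedLink {u v : ℤ} (hu : Even u) (hv : Even v) (hW : W.Primitive)
    {M : Fin c → ℝ → E3} (hM : IsBunchDrawing u v W M) :
    IsCodedLink u v W.length W.letter M := by
  have hM' := W.isBunchDrawing_iff.1 hM
  have hmem : ∀ a (N : ℕ), ∀ t ∈ Icc (0 : ℝ) 1, ∃ s ∈ Icc (0 : ℝ) 1,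
      M a (N + t) = page t (spot u v (W.letter a N) s t) := fun a N t ht =>
    ⟨W.slide a N t, W.slide_mem ht, hM'.2 a N t ht⟩
  refine ⟨⟨W.length_pos, fun a => ?_, hM'.1,
    IsCodedLink.mem_template_of_mem W.length_pos hM'.1 hmem, IsCodedLink.turn_of_mem hmem,
    fun a b τ τ' he => ?_⟩, W.letter_periodic, hmem⟩
  · refine continuous_of_continuousOn_Icc_int fun n => ?_
    -- by periodicity a nonnegative interval of times can be taken
    have hlen : (1 : ℤ) ≤ W.length a := by exact_mod_cast W.length_pos a
    obtain ⟨N, hN⟩ := Int.eq_ofNat_of_zero_le (a := n + |n| * W.length a)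
      (by nlinarith [neg_abs_le n, abs_nonneg n])
    have hN' : (n : ℝ) + (|n| : ℤ) * W.length a = N := by exact_mod_cast hN
    have hcont : Continuous fun x : ℝ => W.drawnTurn u v a N (x - n) :=
      (W.continuous_drawnTurn u v a N).comp (by fun_prop)
    refine hcont.continuousOn.congr fun x hx => ?_
    simp only
    rw [← (hM'.1 a).int_mul |n| x, ← hM'.2 a N (x - n) ⟨by linarith [hx.1], by linarith [hx.2]⟩]
    congr 1
    linarith
  · obtain ⟨N, t, ht, k, hk⟩ := exists_nat_add_eq (T := W.length a)
      (by exact_mod_cast W.length_pos a) τ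
    obtain ⟨N', t', ht', k', hk'⟩ := exists_nat_add_eq (T := W.length b)
      (by exact_mod_cast W.length_pos b) τ'
    have hI : t ∈ Icc (0 : ℝ) 1 := ⟨ht.1, ht.2.le⟩
    have hI' : t' ∈ Icc (0 : ℝ) 1 := ⟨ht'.1, ht'.2.le⟩
    rw [← (hM'.1 a).int_mul k, ← (hM'.1 b).int_mul k', hk, hk', hM'.2 a N t hI,
      hM'.2 b N' t' hI', drawnTurn, drawnTurn] at he
    have hs := W.slide_mem (a := a) (N := N) hI
    have hs' := W.slide_mem (a := b) (N := N') hI'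
    obtain ⟨hz, q, hq⟩ := page_inj (by linarith [(spot_bounds u v (W.letter a N) hs hI).1])
      (by linarith [(spot_bounds u v (W.letter b N') hs' hI').1]) he
    have hq0 : q = 0 := by
      have h1 : (q : ℝ) < 1 := by linarith [ht.1, ht'.2]
      have h2 : (-1 : ℝ) < q := by linarith [ht.2, ht'.1]
      have h1' : q < 1 := by exact_mod_cast h1
      have h2' : -1 < q := by exact_mod_cast h2
      omega
    obtain rfl : t' = t := by rw [hq, hq0]; simp
    have hp : W.point a N = W.point b N' := by
      have hpa := W.point_mem a N
      have hpb := W.point_mem b N'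
      by_cases hw : W.letter a N = W.letter b N'
      · have hsl := congrArg (across u v (W.letter a N) t') hz
        rw [across_spot, hw, across_spot] at hsl
        rcases lt_trichotomy (W.point a N) (W.point b N') with hlt | heq | hlt
        · exact absurd hsl (W.slide_lt hw hlt hI).ne
        · exact heq
        · exact absurd hsl (W.slide_lt hw.symm hlt hI).ne'
      · exfalso
        rcases ht.1.eq_or_lt with h0 | h0
        · rw [← h0] at he
          have h1 := congrArg profile ((W.drawnTurn_zero u v a N).symm.trans
            (he.trans (W.drawnTurn_zero u v b N')))
          rw [profile_page _ (by simp; linarith [(W.point_mem_Icc a N).1]),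
            profile_page _ (by simp; linarith [(W.point_mem_Icc b N').1])] at h1
          have h2 : W.point a N = W.point b N' := by exact_mod_cast h1
          cases ha : W.letter a N <;> cases hb : W.letter b N' <;> rw [ha] at hpa <;>
            rw [hb] at hpb <;> simp [ha, hb] at hw hpa hpb <;> linarith
        · cases ha : W.letter a N <;> cases hb : W.letter b N'
          · simp [ha, hb] at hw
          · rw [ha, hb] at hz
            exact spot_true_ne_spot_false hu hv hs' hs ⟨h0, ht.2⟩ hz.symm
          · rw [ha, hb] at hz
            exact spot_true_ne_spot_false hu hv hs hs' ⟨h0, ht.2⟩ hz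
          · simp [ha, hb] at hw
    obtain ⟨rfl, hmod⟩ := hW.eq_of_point_eq hp
    obtain ⟨r, hr⟩ := (Nat.modEq_iff_dvd.1 hmod)
    refine ⟨rfl, r + k - k', ?_⟩
    have hr' : (N' : ℝ) - N = W.length a * r := by exact_mod_cast hr
    push_cast
    linear_combination hk' - hk + hr'

theorem IsBunchDrawing.pos_eq {u v : ℤ} {M : Fin c → ℝ → E3} (hM : IsBunchDrawing u v W M)
    (a : Fin c) (N : ℕ) : pos M a N = W.point a N := by
  have h := (W.isBunchDrawing_iff.1 hM).2 a N 0 (left_mem_Icc.2 zero_le_one)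
  rw [add_zero, drawnTurn_zero] at h
  have h2 := pageCoord_add_nat 0 N (M a N)
  rw [zero_add] at h2
  rw [pos, coord, h2, h, pageCoord_page, Complex.ofReal_re]

/-- Parallel components of the link drawn are ordered by their numbers. -/
theorem IsBunchDrawing.pos_lt_of_lt {u v : ℤ} (hu : Even u) (hv : Even v) (hW : W.Primitive)
    {M : Fin c → ℝ → E3} (hM : IsBunchDrawing u v W M) {a b : Fin c} (hab : a < b) {N N' : ℕ}
    (h : ∀ n, W.letter a (N + n) = W.letter b (N' + n)) : pos M a N < pos M b N' := by
  obtain ⟨j, i, hag⟩ := W.exists_agree h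
  rw [(hM.isCodedLink hu hv hW).pos_lt_iff_of_itinerary hu hv h hag.letter, hM.pos_eq, hM.pos_eq]
  have h1 := W.point_x (W.k_pos a j) le_rfl
  have h2 := W.point_x (W.k_pos b i) le_rfl
  rw [Nat.sub_self, add_zero] at h1 h2
  rw [h1, h2, show W.k a j = W.k b i from (hag 0).1, W.xPoint_lt_iff (W.k_pos b i)]
  exact Or.inr ⟨W.xTail_eq_iff.2 hag, hab⟩

end

/-! ### Bunches of turns -/

namespace CodeWords

variable {c : ℕ} (W : CodeWords c)

theorem slide_x_zero {a : Fin c} {j k : ℕ} (hk : 1 ≤ k) (hk' : k ≤ W.k a j) :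
    W.slide a (W.xStart a j + (W.k a j - k)) 0 = 2 * W.xPoint k a j := by
  rw [slide, W.letter_x (by omega), W.point_x hk hk']
  simp

theorem slide_y_zero {a : Fin c} {j l : ℕ} (hl : 1 ≤ l) (hl' : l ≤ W.l a j) :
    W.slide a (W.yStart a j + (W.l a j - l)) 0 = 2 * W.yPoint l a j - 1 := by
  rw [slide, W.letter_y (by omega), W.point_y hl hl']
  simp

theorem slide_mem_xBand {a : Fin c} {j k : ℕ} (hk : 1 ≤ k) (hk' : k ≤ W.k a j) {t : ℝ}
    (ht : t ∈ Icc (0 : ℝ) 1) : W.slide a (W.xStart a j + (W.k a j - k)) t ∈ xBand k := by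
  have h1 := W.xPoint_bounds hk a j
  have h2 : W.point a (W.xStart a j + (W.k a j - k) + 1) ∈ xBand k := by
    rw [xBand, mark_neg, mark_neg_add_one hk, pow_succ]
    rcases hk.eq_or_lt with rfl | hk2
    · rw [W.point_x_last]
      have := W.yPoint_mem (W.l_pos a j) a j
      constructor <;> norm_num <;> linarith [this.1, this.2]
    · rw [W.point_x_succ hk2 hk']
      obtain ⟨r, rfl⟩ := Nat.exists_eq_add_of_le' hk
      have := W.xPoint_bounds (by omega : 1 ≤ r + 1 - 1) a j
      rw [Nat.add_sub_cancel] at this ⊢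
      rw [pow_succ] at this ⊢
      constructor <;> linarith [this.1, this.2]
  rw [slide, W.letter_x (by omega), if_pos rfl, W.point_x hk hk']
  refine convex_Icc (2 * mark (-k)) (2 * mark (-k + 1)) ?_ h2 (sub_nonneg.2 ht.2) ht.1 (by ring)
  rw [mark_neg, mark_neg_add_one hk]
  constructor <;> linarith [h1.1, h1.2]

theorem slide_mem_yBand {a : Fin c} {j l : ℕ} (hl : 1 ≤ l) (hl' : l ≤ W.l a j) {t : ℝ}
    (ht : t ∈ Icc (0 : ℝ) 1) : W.slide a (W.yStart a j + (W.l a j - l)) t ∈ yBand l := by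
  have h1 := W.yPoint_bounds hl a j
  have h2 : W.point a (W.yStart a j + (W.l a j - l) + 1) ∈ yBand l := by
    rw [yBand, mark_pos hl, mark_pos_sub_one hl, pow_succ]
    rcases hl.eq_or_lt with rfl | hl2
    · rw [W.point_y_last]
      have := W.xPoint_mem (W.k_pos a (j + 1)) a (j + 1)
      constructor <;> norm_num <;> linarith [this.1, this.2]
    · rw [W.point_y_succ hl2 hl']
      obtain ⟨r, rfl⟩ := Nat.exists_eq_add_of_le' hl
      have := W.yPoint_bounds (by omega : 1 ≤ r + 1 - 1) a j
      rw [Nat.add_sub_cancel] at this ⊢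
      rw [pow_succ] at this ⊢
      constructor <;> linarith [this.1, this.2]
  rw [slide, W.letter_y (by omega), if_neg (by simp), W.point_y hl hl']
  refine convex_Icc (2 * mark (l - 1) - 1) (2 * mark l - 1) ?_ h2 (sub_nonneg.2 ht.2) ht.1 (by ring)
  rw [mark_pos hl, mark_pos_sub_one hl]
  constructor <;> linarith [h1.1, h1.2]

theorem slide_x_lt {a b : Fin c} {j i k : ℕ} (hk : 1 ≤ k) (ha : k ≤ W.k a j) (hb : k ≤ W.k b i)
    (h : W.xRank a j < W.xRank b i) {t : ℝ} (ht : t ∈ Icc (0 : ℝ) 1) :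
    W.slide a (W.xStart a j + (W.k a j - k)) t < W.slide b (W.xStart b i + (W.k b i - k)) t := by
  refine W.slide_lt ?_ ?_ ht
  · rw [W.letter_x (by omega), W.letter_x (by omega)]
  · rw [W.point_x hk ha, W.point_x hk hb, W.xPoint_lt_iff hk]
    exact W.xRank_lt_iff.1 h

theorem slide_y_lt {a b : Fin c} {j i l : ℕ} (hl : 1 ≤ l) (ha : l ≤ W.l a j) (hb : l ≤ W.l b i)
    (h : W.yRank a j < W.yRank b i) {t : ℝ} (ht : t ∈ Icc (0 : ℝ) 1) :
    W.slide a (W.yStart a j + (W.l a j - l)) t < W.slide b (W.yStart b i + (W.l b i - l)) t := by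
  refine W.slide_lt ?_ ?_ ht
  · rw [W.letter_y (by omega), W.letter_y (by omega)]
  · rw [W.point_y hl ha, W.point_y hl hb, W.yPoint_lt_iff hl]
    exact W.yRank_lt_iff.1 h

/-- An injective numbering of the base labels by numbers below their number is a list. -/
theorem exists_list {f : W.Base → ℕ} (hf : Function.Injective f) (hlt : ∀ i, f i < W.trip) :
    ∃ ρ : W.Base ≃ Fin W.trip, ∀ i, (ρ i : ℕ) = f i := by
  have hcard : Fintype.card W.Base = Fintype.card (Fin W.trip) := by
    rw [← Nat.card_eq_fintype_card, card_base, Fintype.card_fin]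
  have hinj : Function.Injective fun i => (⟨f i, hlt i⟩ : Fin W.trip) := fun i j h =>
    hf (Fin.mk.inj_iff.1 h)
  exact ⟨Equiv.ofBijective _ ((Fintype.bijective_iff_injective_and_card _).2 ⟨hinj, hcard⟩),
    fun i => rfl⟩

/-- A renaming of the components and a shift of the indices do not identify base labels. -/
theorem Primitive.relabel_injective {W : CodeWords c} (hW : W.Primitive) {π : Fin c → Fin c}
    (hπ : Function.Injective π) {d : Fin c → ℕ} (hn : ∀ a, W.n (π a) = W.n a) {i i' : W.Base}
    (h : π i.1 = π i'.1 ∧ W.Agree (π i.1) (i.2 + d i.1) (π i'.1) (i'.2 + d i'.1)) : i = i' := by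
  obtain ⟨a, j⟩ := i
  obtain ⟨b, i⟩ := i'
  obtain ⟨h1, h2⟩ := h
  obtain rfl : a = b := hπ h1
  have h3 := Nat.ModEq.add_right_cancel' _ (hW _ _ _ h2)
  rw [hn] at h3
  have h4 : (j : ℕ) = i := h3.eq_of_lt_of_lt j.2 i.2
  rw [Fin.ext h4]

end CodeWords

open CodeWords

/-- The link drawn is a union of bunches, also after a change of the names of the components and
of the starting points that preserves the words. -/
theorem IsBunchDrawing.isUnionOfBunches {u v : ℤ} {c : ℕ} {W : CodeWords c} {M : Fin c → ℝ → E3}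
    (hM : IsBunchDrawing u v W M) {π : Fin c → Fin c} {d : Fin c → ℕ}
    (hd : ∀ a j, W.k (π a) (j + d a) = W.k a j ∧ W.l (π a) (j + d a) = W.l a j)
    {ρx ρy : W.Base ≃ Fin W.trip}
    (hx : ∀ i : W.Base, (ρx i : ℕ) = W.xRank (π i.1) (i.2 + d i.1))
    (hy : ∀ i : W.Base, (ρy i : ℕ) = W.yRank (π i.1) (i.2 + d i.1)) :
    IsUnionOfBunches u v W ρx ρy (fun a τ => M (π a) (τ + W.xStart (π a) (d a))) := by
  have hM' := (W.isBunchDrawing_iff.1 hM).2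
  refine ⟨fun i k t => W.slide (π i.1)
      (W.xStart (π i.1) (i.2 + d i.1) + (W.k (π i.1) (i.2 + d i.1) - k)) t,
    fun i l t => W.slide (π i.1)
      (W.yStart (π i.1) (i.2 + d i.1) + (W.l (π i.1) (i.2 + d i.1) - l)) t,
    fun i k h1 h2 => ?_, fun i l h1 h2 => ?_, fun i i' hlt k h1 h2 h3 t ht => ?_,
    fun i i' hlt l h1 h2 h3 t ht => ?_⟩
  · rw [← (hd i.1 i.2).1] at h2
    refine ⟨?_, fun t ht => ⟨W.slide_mem_xBand h1 h2 ht, ?_⟩⟩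
    · beta_reduce
      rw [W.slide_x_zero h1 h2, negInterval, mark_neg, mark_neg_add_one h1,
        mul_div_cancel_left₀ _ two_ne_zero]
      exact W.xPoint_bounds h1 _ _
    · have h := hM' (π i.1)
        (W.xStart (π i.1) (i.2 + d i.1) + (W.k (π i.1) (i.2 + d i.1) - k)) t ht
      rw [drawnTurn, W.letter_x (by omega), ← leftStrip_eq] at h
      rw [← h, (hd i.1 i.2).1, W.xStart_add_of_relabel (hd i.1)]
      generalize W.k i.1 i.2 - k = r
      beta_reduce
      congr 1
      push_cast
      ring
  · rw [← (hd i.1 i.2).2] at h2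
    refine ⟨?_, fun t ht => ⟨W.slide_mem_yBand h1 h2 ht, ?_⟩⟩
    · beta_reduce
      rw [W.slide_y_zero h1 h2, posInterval, mark_pos h1, mark_pos_sub_one h1,
        add_sub_cancel, mul_div_cancel_left₀ _ two_ne_zero]
      exact W.yPoint_bounds h1 _ _
    · have h := hM' (π i.1)
        (W.yStart (π i.1) (i.2 + d i.1) + (W.l (π i.1) (i.2 + d i.1) - l)) t ht
      rw [drawnTurn, W.letter_y (by omega), ← rightStrip_eq] at h
      rw [← h, (hd i.1 i.2).2, yStart_eq, yStart_eq, (hd i.1 i.2).1,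
        W.xStart_add_of_relabel (hd i.1)]
      generalize W.l i.1 i.2 - l = r
      beta_reduce
      congr 1
      push_cast
      ring
  · rw [← (hd i.1 i.2).1] at h2
    rw [← (hd i'.1 i'.2).1] at h3
    refine W.slide_x_lt h1 h2 h3 ?_ ht
    rw [← hx, ← hx]
    exact hlt
  · rw [← (hd i.1 i.2).2] at h2
    rw [← (hd i'.1 i'.2).2] at h3
    refine W.slide_y_lt h1 h2 h3 ?_ ht
    rw [← hy, ← hy]
    exact hlt

/-! ### Matching parallel components -/

/-- The values of a function on a finite linear order are sorted by a permutation; the function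
need not be injective, as nothing is asked about equal values. -/
theorem exists_perm_lt {S : Type*} [Fintype S] [LinearOrder S] (f : S → ℝ) :
    ∃ e : Equiv.Perm S, ∀ a b, f a < f b → e a < e b := by
  set o := Fintype.orderIsoFinOfCardEq S rfl
  set σ := Tuple.sort (f ∘ o)
  refine ⟨(o.symm.toEquiv.trans σ.symm).trans o.toEquiv, fun a b hab => ?_⟩
  refine o.lt_iff_lt.2 ?_
  by_contra! hle
  have := Tuple.monotone_sort (f ∘ o) hle
  simp [σ] at this
  linarith

/-- In each fibre of `rep`, the values of `f` can be sorted by a permutation. -/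
theorem exists_perm_of_rep {S : Type*} [Fintype S] [LinearOrder S] (rep : S → S) (f : S → ℝ) :
    ∃ π : Equiv.Perm S, (∀ a, rep (π a) = rep a) ∧
      ∀ a b, rep a = rep b → f a < f b → π a < π b := by
  classical
  choose e he using fun r : S => exists_perm_lt (S := {a // rep a = r}) fun a => f a
  set π : Equiv.Perm S := (Equiv.sigmaFiberEquiv rep).symm.trans
    ((Equiv.sigmaCongrRight e).trans (Equiv.sigmaFiberEquiv rep))
  have hπ : ∀ r (x : {a // rep a = r}), π x = e r x := by
    rintro r ⟨a, rfl⟩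
    rfl
  refine ⟨π, fun a => ?_, fun a b hab hlt => ?_⟩
  · rw [hπ (rep a) ⟨a, rfl⟩]
    exact (e (rep a) ⟨a, rfl⟩).2
  · rw [hπ (rep b) ⟨a, hab⟩, hπ (rep b) ⟨b, rfl⟩]
    exact he (rep b) ⟨a, hab⟩ ⟨b, rfl⟩ hlt

/-- A link is isotopic to the drawing of its code words: within each class of parallel components,
the components of the link are matched with those of the drawing in the order of the strands. -/
theorem IsCodedLink.exists_ambientIsotopic {u v : ℤ} (hu : Even u) (hv : Even v) {c : ℕ}
    {W : CodeWords c} {L M : Fin c → ℝ → E3} (hL : IsCodedLink u v W.length W.letter L)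
    (hM : IsBunchDrawing u v W M) : ∃ (π : Equiv.Perm (Fin c)) (d : Fin c → ℕ),
      (∀ a, W.n (π a) = W.n a ∧
        ∀ j, W.k (π a) (j + d a) = W.k a j ∧ W.l (π a) (j + d a) = W.l a j) ∧
      AmbientIsotopic L (fun a τ => M (π a) (τ + W.xStart (π a) (d a))) := by
  have hW := hL.primitive hu hv
  let par : Setoid (Fin c) :=
    { r := fun a b => ∃ j i, W.Agree a j b i
      iseqv :=
        { refl := fun a => ⟨0, 0, fun q => ⟨rfl, rfl⟩⟩
          symm := fun ⟨j, i, h⟩ => ⟨i, j, h.symm⟩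
          trans := fun {a b d} ⟨j, i, h⟩ ⟨i', r, h'⟩ => by
            have h1 := h.add i'
            have h2 := h'.add i
            rw [add_comm i'] at h2
            exact ⟨_, _, h1.trans h2⟩ } }
  set rep : Fin c → Fin c := fun a => (Quotient.mk par a).out
  have hrep : ∀ a b, rep a = rep b ↔ ∃ j i, W.Agree a j b i := fun a b =>
    Quotient.out_inj.trans Quotient.eq
  have hrep' : ∀ a, ∃ e, ∀ j, W.k a (j + e) = W.k (rep a) j ∧ W.l a (j + e) = W.l (rep a) j := by
    intro a
    obtain ⟨j, i, h⟩ : ∃ j i, W.Agree (rep a) j a i := (Quotient.mk_out (s := par) a : _)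
    obtain ⟨e, -, he⟩ := hW.exists_relabel h
    exact ⟨e, he⟩
  choose e he using hrep'
  -- the places of the strands of a class that have the itinerary of its representative
  obtain ⟨π, hπ, hlt⟩ := exists_perm_of_rep rep fun a => pos L a (W.xStart a (e a))
  have hd : ∀ a, ∃ d, W.n (π a) = W.n a ∧
      ∀ j, W.k (π a) (j + d) = W.k a j ∧ W.l (π a) (j + d) = W.l a j := fun a => by
    obtain ⟨j, i, h⟩ := (hrep a (π a)).1 (hπ a).symm
    exact hW.exists_relabel h
  choose d hd using hd
  have hMc := hM.isCodedLink hu hv hW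
  refine ⟨π, d, hd, IsCodedLink.ambientIsotopic_of_parallel hu hv hL
    (hMc.relabel π.injective hd) fun a b N N' hab hw hp => ?_⟩
  rw [IsCodedLink.pos_relabel, IsCodedLink.pos_relabel]
  have hr : rep a = rep b := (hrep a b).2 (W.exists_agree hw)
  refine hM.pos_lt_of_lt hu hv hW (hlt a b hr ?_) fun n => ?_
  · refine (hL.pos_lt_iff_of_itinerary hu hv hw fun n => ?_).1 hp
    rw [add_comm, W.letter_add_of_relabel (he a), hr, add_comm, W.letter_add_of_relabel (he b)]
  · rw [add_right_comm, W.letter_add_of_relabel (hd a).2, add_right_comm,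
      W.letter_add_of_relabel (hd b).2, hw]

end LorenzLike

theorem mainTheorem12 (u v : ℤ) (hu : Even u) (hv : Even v) {c : ℕ} (W : CodeWords c)
    (L : Fin c → ℝ → E3) (hL : IsLorenzLikeLink u v W.length L) (hW : W.IsCodeOf u v L) :
    -- the link is isotopic to a union of bunches of turns
    (∃ (L' : Fin c → ℝ → E3) (ρx ρy : W.Base ≃ Fin W.trip),
      IsLorenzLikeLink u v W.length L' ∧ W.IsCodeOf u v L' ∧
      IsUnionOfBunches u v W ρx ρy L' ∧ AmbientIsotopic L L') ∧
    -- the bunch algorithm draws exactly one link, and constructs the given link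
    (∃! M : Fin c → ℝ → E3, IsBunchDrawing u v W M) ∧
    ∀ M : Fin c → ℝ → E3, IsBunchDrawing u v W M →
      IsLorenzLikeLink u v W.length M ∧ W.IsCodeOf u v M ∧
      (∃ ρx ρy : W.Base ≃ Fin W.trip,
        (∀ i : W.Base, (ρx i : ℕ) = W.xRank i.1 i.2 ∧ (ρy i : ℕ) = W.yRank i.1 i.2) ∧
        IsUnionOfBunches u v W ρx ρy M) ∧
      -- up to the naming of parallel components, that is, of components with the same cyclic word
      ∃ (π : Equiv.Perm (Fin c)) (d : Fin c → ℕ),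
        (∀ a, W.n (π a) = W.n a ∧
          ∀ j, W.k (π a) (j + d a) = W.k a j ∧ W.l (π a) (j + d a) = W.l a j) ∧
        AmbientIsotopic L (fun a τ => M (π a) (τ + W.xStart (π a) (d a))) := by
  have hLc := IsCodedLink.of_isCodeOf hL hW
  have hprim := hLc.primitive hu hv
  -- the ranks of the renamed and shifted labels are a list of all labels
  have hlists : ∀ (π : Fin c → Fin c) (d : Fin c → ℕ), Function.Injective π →
      (∀ a, W.n (π a) = W.n a) → ∃ ρx ρy : W.Base ≃ Fin W.trip,
        ∀ i : W.Base, (ρx i : ℕ) = W.xRank (π i.1) (i.2 + d i.1) ∧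
          (ρy i : ℕ) = W.yRank (π i.1) (i.2 + d i.1) := fun π d hπ hn => by
    obtain ⟨ρx, hx⟩ := W.exists_list (f := fun i => W.xRank (π i.1) (i.2 + d i.1))
      (fun i i' h => hprim.relabel_injective hπ hn (W.xRank_eq_iff.1 h))
      fun i => W.xRank_lt_trip _ _
    obtain ⟨ρy, hy⟩ := W.exists_list (f := fun i => W.yRank (π i.1) (i.2 + d i.1))
      (fun i i' h => hprim.relabel_injective hπ hn (W.yRank_eq_iff.1 h))
      fun i => W.yRank_lt_trip _ _
    exact ⟨ρx, ρy, fun i => ⟨hx i, hy i⟩⟩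
  have hdraw := W.isBunchDrawing_drawnLink hu hv
  refine ⟨?_, ⟨_, hdraw, fun M hM => hM.unique hdraw⟩, fun M hM => ?_⟩
  · obtain ⟨π, d, hd, hiso⟩ := hLc.exists_ambientIsotopic hu hv hdraw
    obtain ⟨ρx, ρy, hρ⟩ := hlists π d π.injective fun a => (hd a).1
    have hc := (hdraw.isCodedLink hu hv hprim).relabel π.injective hd
    exact ⟨_, ρx, ρy, hc.link, hc.isCodeOf, hdraw.isUnionOfBunches (fun a => (hd a).2)
      (fun i => (hρ i).1) (fun i => (hρ i).2), hiso⟩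
  · have hc := hM.isCodedLink hu hv hprim
    obtain ⟨ρx, ρy, hρ⟩ := hlists id (fun _ => 0) Function.injective_id fun _ => rfl
    refine ⟨hc.link, hc.isCodeOf, ⟨ρx, ρy, by simpa using hρ, ?_⟩,
      hLc.exists_ambientIsotopic hu hv hM⟩
    have := hM.isUnionOfBunches (π := id) (d := fun _ => 0) (fun _ _ => ⟨rfl, rfl⟩)
      (fun i => (hρ i).1) (fun i => (hρ i).2)
    simpa [CodeWords.xStart_zero] using this
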